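/- Let $p$ be a prime and let $C$ be an algebraically closed field of characteristic $p$, complete with respect to a nontrivial nonarchimedean absolute value $|\cdot|$. Let $\sigma(c)=c^{1/p}$ and $\mathfrak m=\{c\in C:|c|<1\}$. **Floer side.** Let $T=\mathbf R^2/\mathbf Z^2$ with its standard orientation and the complex structure of $\mathbf C/\mathbf Z[i]$. For $m\in\mathbf Z$ let $L_{(m)}\subset T$ be the image of the line of slope $-m$ through the origin, with base point $\star_{(m)}=(\varepsilon,-m\varepsilon)$ for a fixed irrational $\varepsilon$. Let $\underline C$ be the local system of rings on $T$ pulled back along $(x,y)\mapsto x$ from the local system on $\mathbf R/\mathbf Z$ with étalé space $(\mathbf R\times C)/\big((x,c)\sim(x+1,\sigma(c))\big)$. Its fibres are identified with $C$ using representatives $x\in[0,1)$, and $\nabla\gamma$ denotes parallel transport along a path $\gamma$. Put $\mathrm{CF}(L_{(m)},L_{(n)};\underline{\mathfrak m})=\bigoplus_{x\in L_{(m)}\cap L_{(n)}}x\cdot\mathfrak m$. For integers $m_0<m_1<m_2$, the triangle product at $t=1$, $$\mathrm{CF}(L_{(m_1)},L_{(m_2)})\times \mathrm{CF}(L_{(m_0)},L_{(m_1)})\to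 \mathrm{CF}(L_{(m_0)},L_{(m_2)}),$$ is the biadditive extension of $$(x_2\cdot b,\;x_1\cdot a)\longmapsto\sum_{y\in L_{(m_0)}\cap L_{(m_2)}}y\cdot\sum_{u}\pm\nabla\gamma_2\big(b\,\nabla\gamma_1(a\,\nabla\gamma_0(1))\big).$$ Here $u$ runs over holomorphic triangles, taken up to reparametrization: continuous maps from the closed disk to $T$, smooth away from three counterclockwise marked boundary points and holomorphic in the interior. The marked points go to $y,x_1,x_2$, and the boundary arcs $\gamma_0:y\to x_1$, $\gamma_1:x_1\to x_2$, $\gamma_2:x_2\to y$ lie on $L_{(m_0)},L_{(m_1)},L_{(m_2)}$. The sign of $u$ is $-1$ to the number of boundary points that $u$ maps to $\star_{(m_0)},\star_{(m_1)}$ or $\star_{(m_2)}$. The $k$-fold Dehn twist $\tau^k(x,y)=(x,y-kx)$ induces $\mathrm{CF}(L_{(0)},L_{(n)})\cong\mathrm{CF}(L_{(k)},L_{(n+k)})$. For $m\ge1$ and $0\le k<m$ let $x_{m,k/m}=(k/m,0)\in L_{(0)}\cap L_{(m)}$. **Fargues–Fontaine side.** Let $B$ be the ring of series $\sum_{i\in\mathbf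 Z}b_iz^i$, $b_i\in C$, such that $|b_i|r^i\to0$ as $|i|\to\infty$ for every $r\in(0,1)$. Let $\varphi(\sum c_iz^i)=\sum c_i^pz^i$ and $B^{\varphi=z^n}=\{f\in B:\varphi(f)=z^nf\}$. The Fargues–Fontaine graded ring for $E=\mathbf F_p((z))$ is $\bigoplus_{n\ge0}B^{\varphi=z^n}$, with irrelevant ideal $\bigoplus_{n\ge1}B^{\varphi=z^n}$. **Theorem.** 1. For $m,n\ge1$, all intersection points $x_1\in L_{(0)}\cap L_{(m)}$, $x_2\in L_{(m)}\cap L_{(m+n)}$, $y\in L_{(0)}\cap L_{(m+n)}$ and all $a,b\in\mathfrak m$, the sum over triangles $u$ in the product of $x_2\cdot b$ and $x_1\cdot a$ converges unconditionally in $C$. 2. The product $\beta\cdot\alpha:=\mu_2(\tau^{n_1}\beta,\alpha)$, for $\beta\in\mathrm{CF}(L_{(0)},L_{(n_2)};\underline{\mathfrak m})$ and $\alpha\in\mathrm{CF}(L_{(0)},L_{(n_1)};\underline{\mathfrak m})$, where $\mu_2$ is the triangle product, takes values in $\mathrm{CF}(L_{(0)},L_{(n_1+n_2)};\underline{\mathfrak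 m})$. It makes $\bigoplus_{n\ge1}\mathrm{CF}(L_{(0)},L_{(n)};\underline{\mathfrak m})$ an associative and commutative graded ring without unit. 3. There is an isomorphism of graded rings without unit $$\bigoplus_{n\ge1}\mathrm{CF}(L_{(0)},L_{(n)};\underline{\mathfrak m})\;\cong\;\bigoplus_{n\ge1}B^{\varphi=z^n},\qquad x_{m,k/m}\cdot a\longmapsto\sum_{i\in\mathbf Z}z^{mi+k}\sigma^i(a)$$ for $m\ge 1$, $0\le k<m$ and $a\in\mathfrak m$. -/

import Mathlib

open Filter Topology DirectSum
open scoped ContDiff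

noncomputable section

namespace FloerFF

/-! ## The ring `B` of Fargues and Fontaine in equal characteristic -/

section RingB

variable (C : Type*) [NontriviallyNormedField C]

/-- The growth condition on a family of coefficients `(b_i)`, `i ∈ ℤ`:
for every `r ∈ (0,1)`, `|b_i| r ^ i → 0` as `|i| → ∞`. -/
def InB (b : ℤ → C) : Prop :=
  ∀ r : ℝ, 0 < r → r < 1 → Tendsto (fun i : ℤ => ‖b i‖ * r ^ i) cofinite (𝓝 0)

variable {C}

theorem InB.summable {b : ℤ → C} (hb : InB C b) {r : ℝ} (h0 : 0 < r) (h1 : r < 1) :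
    Summable (fun i : ℤ => ‖b i‖ * r ^ i) := by
  have key : ∀ s : ℝ, 0 < s → s < 1 → ∃ M : ℝ, ∀ i : ℤ, ‖b i‖ * r ^ i ≤ M * (r / s) ^ i := by
    intro s hs0 hs1
    obtain ⟨M, hM⟩ := (hb s hs0 hs1).bddAbove_range_of_cofinite
    refine ⟨M, fun i => ?_⟩
    have h2 : ‖b i‖ * s ^ i ≤ M := hM ⟨i, rfl⟩
    have h3 : ‖b i‖ * r ^ i = (‖b i‖ * s ^ i) * (r / s) ^ i := by
      rw [div_zpow]
      field_simp
    rw [h3]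
    exact mul_le_mul_of_nonneg_right h2 (by positivity)
  apply Summable.of_nat_of_neg
  · obtain ⟨M, hM⟩ := key ((1 + r) / 2) (by linarith) (by linarith)
    have hq : r / ((1 + r) / 2) < 1 := by
      rw [div_lt_one (by linarith)]
      linarith
    refine Summable.of_nonneg_of_le (fun n => by positivity) (fun n => hM n) ?_
    simp only [zpow_natCast]
    exact (summable_geometric_of_lt_one (by positivity) hq).mul_left M
  · obtain ⟨M, hM⟩ := key (r / 2) (by linarith) (by linarith)
    refine Summable.of_nonneg_of_le (fun n => by positivity) (fun n => hM (-(n : ℤ))) ?_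
    have e : ∀ n : ℕ, M * (r / (r / 2)) ^ (-(n : ℤ)) = M * ((1 : ℝ) / 2) ^ n := by
      intro n
      have : r / (r / 2) = 2 := by field_simp
      rw [this, zpow_neg, zpow_natCast]
      simp
    simp only [e]
    exact (summable_geometric_of_lt_one (by norm_num) (by norm_num)).mul_left M

theorem InB.of_summable {b : ℤ → C}
    (h : ∀ r : ℝ, 0 < r → r < 1 → Summable (fun i : ℤ => ‖b i‖ * r ^ i)) : InB C b :=
  fun r h0 h1 => (h r h0 h1).tendsto_cofinite_zero

theorem InB.summable_conv {b c : ℤ → C} (hb : InB C b) (hc : InB C c) {r : ℝ}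
    (h0 : 0 < r) (h1 : r < 1) :
    Summable (fun q : ℤ × ℤ => ‖b q.2 * c (q.1 - q.2)‖ * r ^ q.1) := by
  have h := (hb.summable h0 h1).mul_of_nonneg (hc.summable h0 h1)
    (fun i => by positivity) (fun i => by positivity)
  have hi : Function.Injective (fun q : ℤ × ℤ => (q.2, q.1 - q.2)) := by
    rintro ⟨a, b⟩ ⟨c, d⟩ h
    simp only [Prod.mk.injEq] at h ⊢
    omega
  refine (h.comp_injective hi).congr fun q => ?_
  simp only [Function.comp_apply, norm_mul]
  have : r ^ q.1 = r ^ q.2 * r ^ (q.1 - q.2) := by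
    rw [← zpow_add₀ h0.ne']
    congr 1
    ring
  rw [this]
  ring

/-- The coefficients of the product of two bi-infinite series. -/
def conv (b c : ℤ → C) : ℤ → C := fun n => ∑' i : ℤ, b i * c (n - i)

theorem conv_comm (b c : ℤ → C) : conv b c = conv c b := by
  funext n
  unfold conv
  rw [← (Equiv.subLeft n).tsum_eq]
  refine tsum_congr fun i => ?_
  simp [mul_comm]

theorem inB_single (n : ℤ) (a : C) : InB C (Pi.single n a) := by
  refine InB.of_summable fun r _ _ => ?_
  refine summable_of_ne_finset_zero (s := {n}) fun i hi => ?_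
  simp only [Finset.mem_singleton] at hi
  simp [Pi.single_eq_of_ne hi]

theorem single_conv (n : ℤ) (a : C) (b : ℤ → C) (j : ℤ) :
    conv (Pi.single n a) b j = a * b (j - n) := by
  unfold conv
  rw [tsum_eq_single n (fun i hi => by simp [Pi.single_eq_of_ne hi])]
  simp

theorem InB.add {b c : ℤ → C} (hb : InB C b) (hc : InB C c) : InB C (b + c) := by
  refine InB.of_summable fun r h0 h1 => ?_
  refine Summable.of_nonneg_of_le (fun n => by positivity) (fun n => ?_)
    ((hb.summable h0 h1).add (hc.summable h0 h1))
  rw [← add_mul]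
  exact mul_le_mul_of_nonneg_right (norm_add_le _ _) (by positivity)

theorem InB.neg {b : ℤ → C} (hb : InB C b) : InB C (-b) := by
  intro r h0 h1
  simpa using hb r h0 h1

theorem InB.pow {b : ℤ → C} (hb : InB C b) {p : ℕ} (hp : p ≠ 0) :
    InB C (fun i => b i ^ p) := by
  intro r h0 h1
  have hp' : (p : ℝ) ≠ 0 := by exact_mod_cast hp
  have hs0 : 0 < r ^ (1 / (p : ℝ)) := Real.rpow_pos_of_pos h0 _
  have hs1 : r ^ (1 / (p : ℝ)) < 1 := Real.rpow_lt_one h0.le h1 (by positivity)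
  have h := (hb _ hs0 hs1).pow p
  rw [zero_pow hp] at h
  refine h.congr fun i => ?_
  have e : (r ^ (1 / (p : ℝ))) ^ p = r := by
    rw [← Real.rpow_natCast, ← Real.rpow_mul h0.le, one_div, inv_mul_cancel₀ hp', Real.rpow_one]
  rw [mul_pow, norm_pow, ← zpow_natCast (((r ^ (1 / (p : ℝ))) ^ i)) p, ← zpow_mul, mul_comm i,
    zpow_mul, zpow_natCast, e]

theorem InB.conv {b c : ℤ → C} (hb : InB C b) (hc : InB C c) : InB C (conv b c) := by
  refine InB.of_summable fun r h0 h1 => ?_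
  have h := hb.summable_conv hc h0 h1
  refine Summable.of_nonneg_of_le (fun n => by positivity) (fun n => ?_) h.prod
  have hs : Summable fun i : ℤ => ‖b i * c (n - i)‖ := by
    have h2 := (h.prod_factor n).mul_right (r ^ n)⁻¹
    refine h2.congr fun i => ?_
    field_simp
  have e : ∑' i : ℤ, ‖b i * c (n - i)‖ * r ^ n = (∑' i : ℤ, ‖b i * c (n - i)‖) * r ^ n :=
    tsum_mul_right
  exact (mul_le_mul_of_nonneg_right (norm_tsum_le_tsum_norm hs) (by positivity)).trans_eq e.symm

variable (C)

/-- The additive group of bi-infinite series `∑ b_i z ^ i` with coefficients in `C` that satisfy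
the growth condition. -/
def bSubgroup : AddSubgroup (ℤ → C) where
  carrier := {b | InB C b}
  add_mem' hb hc := InB.add hb hc
  zero_mem' := by
    intro r _ _
    simp
  neg_mem' hb := InB.neg hb

/-- The ring `B`: all series `∑_{i ∈ ℤ} b_i z ^ i`, `b_i ∈ C`, with `|b_i| r ^ i → 0` as
`|i| → ∞` for every `r ∈ (0,1)`, under the multiplication of series. -/
def B : Type _ := ↥(bSubgroup C)

instance : AddCommGroup (B C) := inferInstanceAs (AddCommGroup ↥(bSubgroup C))

variable {C}

/-- The coefficient of `z ^ i`. -/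
def B.coeff (b : B C) : ℤ → C := b.1

theorem B.ext {b c : B C} (h : b.coeff = c.coeff) : b = c := Subtype.ext h

theorem B.coeff_add (b c : B C) : (b + c).coeff = b.coeff + c.coeff := rfl

instance : Mul (B C) := ⟨fun b c => ⟨conv b.1 c.1, InB.conv b.2 c.2⟩⟩

theorem B.coeff_mul (b c : B C) : (b * c).coeff = conv b.coeff c.coeff := rfl

theorem B.mul_comm' (b c : B C) : b * c = c * b := B.ext (conv_comm _ _)

/-- The monomial `a z ^ n`. -/
def B.monomial (n : ℤ) (a : C) : B C := ⟨Pi.single n a, inB_single n a⟩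

instance : One (B C) := ⟨B.monomial 0 1⟩

theorem B.one_mul' (b : B C) : 1 * b = b := by
  refine B.ext (funext fun n => ?_)
  refine (single_conv 0 1 _ n).trans ?_
  simp [B.coeff]

variable [CompleteSpace C]

theorem InB.summable_coeff {b c : ℤ → C} (hb : InB C b) (hc : InB C c) (n : ℤ) :
    Summable (fun i : ℤ => b i * c (n - i)) := by
  have h := (hb.summable_conv hc (r := 1 / 2) (by norm_num) (by norm_num)).prod_factor n
  refine Summable.of_norm ?_
  have h2 := h.mul_right (((1 : ℝ) / 2) ^ n)⁻¹
  refine h2.congr fun i => ?_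
  field_simp

theorem conv_assoc {a b c : ℤ → C} (ha : InB C a) (hb : InB C b) (hc : InB C c) :
    FloerFF.conv (FloerFF.conv a b) c = FloerFF.conv a (FloerFF.conv b c) := by
  funext n
  have h3 : Summable (fun q : ℤ × ℤ => a q.2 * b (q.1 - q.2) * c (n - q.1)) := by
    refine Summable.of_norm ?_
    have h0 : (0 : ℝ) < 1 / 2 := by norm_num
    have h1 : (1 / 2 : ℝ) < 1 := by norm_num
    have h := ((ha.summable h0 h1).mul_of_nonneg (hb.summable h0 h1)
      (fun i => by positivity) (fun i => by positivity)).mul_of_nonneg (hc.summable h0 h1)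
      (fun i => by positivity) (fun i => by positivity)
    have hi : Function.Injective
        (fun q : ℤ × ℤ => (((q.2, q.1 - q.2), n - q.1) : (ℤ × ℤ) × ℤ)) := by
      rintro ⟨a, b⟩ ⟨c, d⟩ h
      simp only [Prod.mk.injEq] at h ⊢
      omega
    refine ((h.comp_injective hi).mul_right (((1 : ℝ) / 2) ^ n)⁻¹).congr fun q => ?_
    simp only [Function.comp_apply, norm_mul]
    have : ((1 : ℝ) / 2) ^ n
        = (1 / 2) ^ q.2 * (1 / 2) ^ (q.1 - q.2) * (1 / 2) ^ (n - q.1) := by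
      rw [← zpow_add₀ h0.ne', ← zpow_add₀ h0.ne']
      congr 1
      ring
    rw [this]
    field_simp
  calc FloerFF.conv (FloerFF.conv a b) c n
      = ∑' k : ℤ, ∑' i : ℤ, a i * b (k - i) * c (n - k) := by
        unfold FloerFF.conv
        exact tsum_congr fun k => tsum_mul_right.symm
    _ = ∑' i : ℤ, ∑' k : ℤ, a i * b (k - i) * c (n - k) :=
        (Summable.tsum_comm (f := fun k i : ℤ => a i * b (k - i) * c (n - k)) h3).symm
    _ = ∑' i : ℤ, a i * ∑' j : ℤ, b j * c (n - i - j) := by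
        refine tsum_congr fun i => ?_
        rw [← tsum_mul_left, ← (Equiv.subRight i).tsum_eq (fun j => a i * (b j * c (n - i - j)))]
        refine tsum_congr fun k => ?_
        simp only [Equiv.subRight_apply]
        rw [mul_assoc, show n - i - (k - i) = n - k by ring]

theorem B.mul_add' (b c d : B C) : b * (c + d) = b * c + b * d := by
  refine B.ext (funext fun n => ?_)
  have h1 := InB.summable_coeff b.2 c.2 n
  have h2 := InB.summable_coeff b.2 d.2 n
  refine Eq.trans (tsum_congr fun i => ?_) (h1.tsum_add h2)
  exact mul_add _ _ _

theorem B.mul_zero' (b : B C) : b * 0 = 0 := by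
  have h := B.mul_add' b 0 0
  rw [add_zero] at h
  exact left_eq_add.mp h

instance : CommRing (B C) where
  __ := (inferInstance : AddCommGroup (B C))
  mul := (· * ·)
  one := 1
  mul_assoc a b c := B.ext (conv_assoc a.2 b.2 c.2)
  mul_comm := B.mul_comm'
  one_mul := B.one_mul'
  mul_one b := (B.mul_comm' _ _).trans (B.one_mul' b)
  left_distrib := B.mul_add'
  right_distrib b c d := by
    rw [B.mul_comm', B.mul_add', B.mul_comm' d b, B.mul_comm' d c]
  zero_mul b := (B.mul_comm' _ _).trans (B.mul_zero' b)
  mul_zero := B.mul_zero'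

variable (C)

/-- The element `z` of `B`. -/
def B.z : B C := B.monomial 1 1

/-- The endomorphism `φ (∑ c_i z ^ i) = ∑ c_i ^ p z ^ i` of `B`. -/
def B.phi (p : ℕ) [Fact p.Prime] [CharP C p] : B C →+* B C where
  toFun b := ⟨fun i => b.coeff i ^ p, InB.pow b.2 (Fact.out : p.Prime).ne_zero⟩
  map_zero' := B.ext (funext fun _ => zero_pow (Fact.out : p.Prime).ne_zero)
  map_one' := by
    refine B.ext (funext fun i => ?_)
    change (Pi.single (0 : ℤ) (1 : C) : ℤ → C) i ^ p = (Pi.single (0 : ℤ) (1 : C) : ℤ → C) i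
    by_cases h : i = 0
    · subst h
      simp
    · simp [Pi.single_eq_of_ne h, (Fact.out : p.Prime).ne_zero]
  map_add' b c := B.ext (funext fun i => add_pow_char (b.coeff i) (c.coeff i) p)
  map_mul' b c := by
    refine B.ext (funext fun n => ?_)
    have h := (InB.summable_coeff b.2 c.2 n).map_tsum (frobenius C p) (continuous_pow p)
    refine h.trans (tsum_congr fun i => ?_)
    exact mul_pow _ _ _

/-- `B^{φ = z ^ n} = {f ∈ B | φ f = z ^ n f}`. -/
def eigen (p : ℕ) [Fact p.Prime] [CharP C p] (n : ℕ) : AddSubgroup (B C) where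
  carrier := {f | B.phi C p f = B.z C ^ n * f}
  add_mem' {f g} hf hg := by
    simp only [Set.mem_ofPred_eq] at hf hg ⊢
    rw [map_add, hf, hg, mul_add]
  zero_mem' := by simp
  neg_mem' {f} hf := by
    simp only [Set.mem_ofPred_eq] at hf ⊢
    rw [map_neg, hf, mul_neg]

instance (p : ℕ) [Fact p.Prime] [CharP C p] : SetLike.GradedMonoid (eigen C p) where
  one_mem := by
    change B.phi C p 1 = B.z C ^ 0 * 1
    simp
  mul_mem {i j} f g hf hg := by
    change B.phi C p f = B.z C ^ i * f at hf
    change B.phi C p g = B.z C ^ j * g at hg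
    change B.phi C p (f * g) = B.z C ^ (i + j) * (f * g)
    rw [map_mul, hf, hg, pow_add]
    ring

/-- The Fargues–Fontaine graded ring `⨁_{n ≥ 0} B^{φ = z ^ n}` for `E = 𝔽_p((z))`. -/
abbrev FFRing (p : ℕ) [Fact p.Prime] [CharP C p] : Type _ := ⨁ n : ℕ, eigen C p n

/-- The irrelevant ideal `⨁_{n ≥ 1} B^{φ = z ^ n}`: the elements of the graded ring with vanishing
degree-zero component. -/
def irrelevantIdeal (p : ℕ) [Fact p.Prime] [CharP C p] : Ideal (FFRing C p) where
  carrier := {f | f 0 = 0}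
  add_mem' {f g} hf hg := by
    simp only [Set.mem_ofPred_eq] at hf hg ⊢
    rw [DirectSum.add_apply, hf, hg, add_zero]
  zero_mem' := rfl
  smul_mem' c f hf := by
    simp only [Set.mem_ofPred_eq, smul_eq_mul] at hf ⊢
    apply Subtype.ext
    rw [DirectSum.coe_mul_apply_eq_sum_antidiagonal]
    simp [hf]

end RingB

/-! ## Lagrangian circles on the torus and holomorphic triangles -/

/-- The torus `T = ℝ² / ℤ²`. -/
abbrev Torus : Type := UnitAddCircle × UnitAddCircle

/-- The universal covering `ℝ² → T`, with `ℝ²` identified with `ℂ` by `(x, y) ↦ x + i y`. The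
orientation `dx dy` and the complex structure of `T` are those for which it is a local
biholomorphism. -/
def cover (w : ℂ) : Torus := ((w.re : UnitAddCircle), (w.im : UnitAddCircle))

/-- `L_(m)`: the image in `T` of the line of slope `-m` through the origin. -/
def lag (m : ℤ) : Set Torus := Set.range fun s : ℝ => cover ⟨s, -(m * s)⟩

/-- The base point `⋆_(m) = (ε, -m ε)` of `L_(m)`, which gives `L_(m)` its nontrivial spin
structure. -/
def star (ε : ℝ) (m : ℤ) : Torus := cover ⟨ε, -(m * ε)⟩

/-- The closed unit disk. -/
abbrev Disk : Type := ↥(Metric.closedBall (0 : ℂ) 1)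

/-- The boundary point `exp (2 π i s)` of the disk. -/
def bdryPt (s : ℝ) : Disk :=
  ⟨Complex.exp (2 * Real.pi * s * Complex.I), by
    have h := Complex.norm_exp_ofReal_mul_I (2 * Real.pi * s)
    push_cast at h
    simp [h]⟩

theorem continuous_bdryPt : Continuous bdryPt := by
  unfold bdryPt
  fun_prop

/-- The `j`-th of the three marked boundary points `z_0, z_1, z_2`, in counterclockwise order. -/
def vertex (j : Fin 3) : Disk := bdryPt ((j : ℝ) / 3)

/-- The counterclockwise boundary arc that starts at `z_j` and ends at the next marked point. -/
def side (j : Fin 3) : C(unitInterval, Disk) :=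
  ⟨fun t => bdryPt (((j : ℝ) + t) / 3), continuous_bdryPt.comp (by fun_prop)⟩

/-- The moduli space `𝓜(y, x₁, x₂)` of holomorphic triangles with boundary on `(L₀, L₁, L₂)`:
continuous maps `u : D → T`, smooth away from the marked points and holomorphic in the interior,
with `z_0, z_1, z_2` going to `y, x₁, x₂` and the arcs `z_0 z_1`, `z_1 z_2`, `z_2 z_0` going into
`L₀`, `L₁`, `L₂`. As `PSL₂(ℝ)` acts simply transitively on counterclockwise triples of boundary
points, every class of triangles up to reparametrization has exactly one representative whose
marked points are the three points `vertex j`. -/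
structure HolTriangle (L₀ L₁ L₂ : Set Torus) (y x₁ x₂ : Torus) where
  /-- The map. -/
  u : C(Disk, Torus)
  vertex_zero : u (vertex 0) = y
  vertex_one : u (vertex 1) = x₁
  vertex_two : u (vertex 2) = x₂
  side_zero : ∀ t, u (side 0 t) ∈ L₀
  side_one : ∀ t, u (side 1 t) ∈ L₁
  side_two : ∀ t, u (side 2 t) ∈ L₂
  smooth : ∀ w : Disk, (∀ j, w ≠ vertex j) → ∃ f : ℂ → ℂ,
    ContDiffWithinAt ℝ ∞ f (Metric.closedBall 0 1) w ∧ ∀ᶠ v : Disk in 𝓝 w, u v = cover (f v)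
  holomorphic : ∀ w : Disk, ‖(w : ℂ)‖ < 1 → ∃ f : ℂ → ℂ,
    AnalyticAt ℂ f w ∧ ∀ᶠ v : Disk in 𝓝 w, u v = cover (f v)

/-- The sign of a triangle on `L_(m₀), L_(m₁), L_(m₂)`, `m₀ < m₁ < m₂` (so that all Maslov indices
vanish): the parity of the number of base points `⋆` that are met along the boundary. -/
def HolTriangle.sign (ε : ℝ) (m₀ m₁ m₂ : ℤ) {L₀ L₁ L₂ : Set Torus} {y x₁ x₂ : Torus}
    (T : HolTriangle L₀ L₁ L₂ y x₁ x₂) : ℤ :=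
  (-1) ^ Set.ncard {w : Disk | ‖(w : ℂ)‖ = 1 ∧
    (T.u w = star ε m₀ ∨ T.u w = star ε m₁ ∨ T.u w = star ε m₂)}

/-! ## The local system and the triangle product at `t = 1` -/

section Floer

variable {C : Type*} [CommRing C] (σ : C ≃+* C)

/-- Lift to `ℝ` of the first coordinate of a path in `T`, starting in `[0,1)`. -/
def liftFst (γ : C(unitInterval, Torus)) : C(unitInterval, ℝ) :=
  (AddCircle.isCoveringMap_coe (1 : ℝ)).liftPath
    (⟨fun t => (γ t).1, by fun_prop⟩ : C(unitInterval, UnitAddCircle))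
    (AddCircle.equivIco (1 : ℝ) 0 (γ 0).1 : ℝ)
    (AddCircle.coe_equivIco (p := (1 : ℝ)) (a := 0) (y := (γ 0).1)).symm

/-- Parallel transport `∇γ` in the local system of rings on `T` that is pulled back along
`(x, y) ↦ x` from the local system on `S¹ = ℝ / ℤ` with étalé space `(ℝ × C) / ~`,
`(x, c) ~ (x + 1, σ c)`. Every fibre is identified with `C` by means of the representative of `x`
in `[0,1)`. If `γ` lifts to a path from `x₀ ∈ [0,1)` to `x₁`, it carries the class of `(x₀, c)` to
that of `(x₁, c)`, which is the class of `(x₁ - ⌊x₁⌋, σ ^ (-⌊x₁⌋) c)`. -/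
def transport (γ : C(unitInterval, Torus)) : C ≃+* C := (σ : RingAut C) ^ (-⌊liftFst γ 1⌋)

/-- The Floer cochains `CF(L, L') = ⨁_{x ∈ L ∩ L'} A`; here `A` is the typical fibre of the local
system of coefficients, every fibre being identified with it as in `transport`. -/
abbrev CF (L L' : Set Torus) (A : Type*) [Zero A] : Type _ := ↥(L ∩ L') →₀ A

/-- The contribution `± ∇γ₂ (b ∇γ₁ (a ∇γ₀ 1))` of a triangle to the product of `x₂ · b` and
`x₁ · a`, where `γ_j` is the `j`-th side. -/
def triangleTerm (ε : ℝ) (m₀ m₁ m₂ : ℤ) {y x₁ x₂ : Torus} (b a : C)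
    (T : HolTriangle (lag m₀) (lag m₁) (lag m₂) y x₁ x₂) : C :=
  T.sign ε m₀ m₁ m₂ •
    transport σ (T.u.comp (side 2))
      (b * transport σ (T.u.comp (side 1)) (a * transport σ (T.u.comp (side 0)) 1))

variable [TopologicalSpace C]

/-- The triangle product
`CF(L_(m₁), L_(m₂)) × CF(L_(m₀), L_(m₁)) → CF(L_(m₀), L_(m₂))` at `t = 1`: the coefficient at `y`
of the product of `β` and `α`, the biadditive extension of the sum of the contributions of all
triangles. It is meaningful where these sums converge. -/
def triangleProduct (ε : ℝ) (m₀ m₁ m₂ : ℤ) (β : CF (lag m₁) (lag m₂) C)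
    (α : CF (lag m₀) (lag m₁) C) (y : ↥(lag m₀ ∩ lag m₂)) : C :=
  β.sum fun x₂ b => α.sum fun x₁ a =>
    ∑' T : HolTriangle (lag m₀) (lag m₁) (lag m₂) y x₁ x₂, triangleTerm σ ε m₀ m₁ m₂ b a T

end Floer

/-- The `k`-fold Dehn twist `τ ^ k`, `(x, y) ↦ (x, y - k x)`. -/
def dehn (k : ℤ) (x : Torus) : Torus := (x.1, x.2 - k • x.1)

theorem dehn_mem_lag {k m n : ℤ} (h : n = m + k) {x : Torus} (hx : x ∈ lag m) :
    dehn k x ∈ lag n := by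
  obtain ⟨s, rfl⟩ := hx
  refine ⟨s, ?_⟩
  subst h
  simp only [cover, dehn]
  congr 1
  rw [← AddCircle.coe_zsmul, ← AddCircle.coe_sub]
  congr 1
  simp
  ring

/-- The isomorphism `CF(L_(m), L_(n)) → CF(L_(m+k), L_(n+k))` induced by the `k`-fold Dehn twist,
which preserves the first coordinate and so acts by the identity on the fibres. -/
def dehnCF {A : Type*} [AddCommMonoid A] (k : ℤ) {m n m' n' : ℤ} (hm : m' = m + k)
    (hn : n' = n + k) (α : CF (lag m) (lag n) A) : CF (lag m') (lag n') A :=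
  α.mapDomain fun x : ↥(lag m ∩ lag n) =>
    ⟨dehn k x, dehn_mem_lag hm x.2.1, dehn_mem_lag hn x.2.2⟩

/-- The intersection point `x_{m,κ} = (κ, 0)` of `L_(0)` and `L_(m)`, for `κ = k / m`. -/
def intPt (m : ℕ+) (k : ℕ) : ↥(lag 0 ∩ lag (m : ℕ)) :=
  ⟨cover ⟨(k : ℝ) / (m : ℕ), 0⟩, ⟨(k : ℝ) / (m : ℕ), by simp⟩, ⟨(k : ℝ) / (m : ℕ), by
    have hm : ((m : ℕ) : ℝ) ≠ 0 := by exact_mod_cast m.ne_zero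
    simp only [cover]
    congr 1
    have e : -((((m : ℕ) : ℤ) : ℝ) * ((k : ℝ) / (m : ℕ))) = (-(k : ℤ)) • (1 : ℝ) := by
      push_cast
      field_simp
      simp
    rw [e, AddCircle.coe_zsmul, AddCircle.coe_period]
    simp⟩⟩

/-! ## Coefficients in the maximal ideal -/

section MaximalIdeal

variable (C : Type*) [NontriviallyNormedField C] [IsUltrametricDist C]

/-- `𝔪 = {c ∈ C : |c| < 1}`. -/
def maxIdeal : AddSubgroup C where
  carrier := {c | ‖c‖ < 1}
  add_mem' {a b} ha hb := lt_of_le_of_lt (IsUltrametricDist.norm_add_le_max a b) (max_lt ha hb)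
  zero_mem' := by simp
  neg_mem' {a} ha := by simpa using ha

/-- `CF(L_(0), L_(n); 𝔪)`. -/
abbrev CFm (n : ℕ+) : Type _ := CF (lag 0) (lag (n : ℕ)) (maxIdeal C)

variable {C}

/-- The inclusion `CF(L_(0), L_(n); 𝔪) ⊆ CF(L_(0), L_(n); C)`. -/
def CFm.incl {n : ℕ+} (α : CFm C n) : CF (lag 0) (lag (n : ℕ)) C :=
  α.mapRange Subtype.val rfl

/-- The `p`-th root map. -/
def pthRoot (C : Type*) [CommRing C] (p : ℕ) [ExpChar C p] [PerfectRing C p] : C ≃+* C :=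
  (frobeniusEquiv C p).symm

/-- The product of `β ∈ CF(L_(0), L_(n₂); 𝔪)` and `α ∈ CF(L_(0), L_(n₁); 𝔪)`: the coefficients of
the triangle product of `τ ^ n₁ β ∈ CF(L_(n₁), L_(n₂+n₁))` and `α`. -/
def gradedProduct (σ : C ≃+* C) (ε : ℝ) {n₂ n₁ : ℕ+} (β : CFm C n₂) (α : CFm C n₁)
    (y : ↥(lag 0 ∩ lag ((n₂ + n₁ : ℕ+) : ℕ))) : C :=
  triangleProduct σ ε 0 (n₁ : ℕ) ((n₂ + n₁ : ℕ+) : ℕ)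
    (dehnCF (n₁ : ℕ) (by simp) (by simp) β.incl) α.incl y

end MaximalIdeal

/-- The coefficients of the series `∑_{i ∈ ℤ} z ^ (m i + k) σ ^ i (a)`. -/
def theta {C : Type*} [CommRing C] (σ : C ≃+* C) (m k : ℤ) (a : C) (j : ℤ) : C :=
  if m ∣ j - k then ((σ : RingAut C) ^ ((j - k) / m)) a else 0

end FloerFF

end

/-!
The proof makes the triangle product explicit and recognises it as the product of series in `B`.

*Holomorphic triangles.* The disk is simply connected, so a holomorphic triangle with sides on
`L_(0)`, `L_(p)`, `L_(q)` lifts to `ℂ`, and each side of the lift stays on one line of slope `0`,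
`-p`, `-q`. Two lifts on the same three lines differ by a holomorphic function whose boundary values
lie on three lines through the origin; by the open mapping theorem such a function is constant
(`eq_const_of_boundary_subset_lines`), so a lift is determined by the lines. Conversely the
Schwarz–Christoffel integral with angles `arctan p`, `arctan q - arctan p`, `π - arctan q` is
continuous on the closed disk, holomorphic across the boundary away from the marked points, and maps
the three arcs monotonically to segments of slopes `0`, `-p`, `-q` (`modelMap`). Rescaling it by a
real factor, positive, negative or zero, produces every triangle, because the given slopes force the
counterclockwise orientation. Hence every lift is a rescaled model triangle
(`lift_eq_modelLift`), and all rescaled model triangles with the right vertices occur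
(`exists_holTriangle`).

*Signs and transport.* A boundary point goes to a base point exactly when its first coordinate is
`ε` modulo `1`. Along the boundary of a nonconstant triangle the first coordinate moves in one
direction on the second arc and in the opposite direction on the two others, so it takes each value
other than those at the two turning points equally often both ways; the vertices have rational
coordinates, and all signs are `+1` (`sign_eq_one`). If the first coordinates of the lifted vertices
are `X₀ ∈ [0, 1)`, `X₁`, `X₂`, parallel transport turns the contribution of the triangle into
`σ ^ ⌊X₁⌋ (a) · σ ^ ⌊X₂⌋ (b)` (`triangleTerm_eq`).

*Counting.* With `q = p + n` and `X₀ = k / q`, the closing condition is `p X₁ + n X₂ = k`. Writing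
`l = p X₁`, the triangles with given vertices correspond to the integers `l` for which the
coefficients of `z ^ l` and `z ^ (k - l)` in the theta series of `a` and `b` may be nonzero
(`exists_triangle_index`). So the sum over triangles is the coefficient of `z ^ k` in the product of
the two theta series, and it converges because these series lie in `B` (`hasSum_triangleTerm`).

*Algebra.* A series in `B^{φ = z ^ n}` satisfies `c_{j - n} = c_j ^ p`, so it is determined by its
coefficients with index in `[0, n)`. The growth condition towards `-∞` holds exactly when these have
absolute value less than `1`. This identifies `CF(L_(0), L_(n); 𝔪)` with `B^{φ = z ^ n}`
(`cfHom_bijective`) compatibly with products (`gradedProduct_eq_coeff`), and associativity and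
commutativity are inherited from `B`.
-/

noncomputable section

namespace FloerFF

open ComplexConjugate

/-! ### The marked points of the disk -/

theorem coe_bdryPt (s : ℝ) : (bdryPt s : ℂ) = Complex.exp (2 * Real.pi * s * Complex.I) := rfl

theorem norm_bdryPt (s : ℝ) : ‖(bdryPt s : ℂ)‖ = 1 := by
  have h := Complex.norm_exp_ofReal_mul_I (2 * Real.pi * s)
  push_cast at h
  simpa [coe_bdryPt] using h

theorem norm_vertex (j : Fin 3) : ‖(vertex j : ℂ)‖ = 1 := norm_bdryPt _

theorem vertex_mul_conj (j : Fin 3) : (vertex j : ℂ) * conj (vertex j : ℂ) = 1 := by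
  rw [Complex.mul_conj, Complex.normSq_eq_norm_sq, norm_vertex]
  simp

theorem conj_bdryPt (s : ℝ) :
    conj (bdryPt s : ℂ) = Complex.exp (-(2 * Real.pi * s * Complex.I)) := by
  rw [coe_bdryPt, ← Complex.exp_conj]
  simp [map_ofNat]

theorem bdryPt_re (s : ℝ) : (bdryPt s : ℂ).re = Real.cos (2 * Real.pi * s) := by
  have := Complex.exp_ofReal_mul_I_re (2 * Real.pi * s)
  push_cast at this
  rw [coe_bdryPt, this]

theorem bdryPt_im (s : ℝ) : (bdryPt s : ℂ).im = Real.sin (2 * Real.pi * s) := by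
  have := Complex.exp_ofReal_mul_I_im (2 * Real.pi * s)
  push_cast at this
  rw [coe_bdryPt, this]

theorem coe_vertex_zero : (vertex 0 : ℂ) = 1 := by
  simp [vertex, coe_bdryPt]

theorem coe_vertex_one : (vertex 1 : ℂ) = ⟨-1 / 2, √3 / 2⟩ := by
  apply Complex.ext
  · rw [vertex, bdryPt_re, show 2 * Real.pi * (((1 : Fin 3) : ℕ) / 3 : ℝ) = Real.pi - Real.pi / 3 by
      simp; ring, Real.cos_pi_sub, Real.cos_pi_div_three]
    norm_num
  · rw [vertex, bdryPt_im, show 2 * Real.pi * (((1 : Fin 3) : ℕ) / 3 : ℝ) = Real.pi - Real.pi / 3 by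
      simp; ring, Real.sin_pi_sub, Real.sin_pi_div_three]

theorem coe_vertex_two : (vertex 2 : ℂ) = ⟨-1 / 2, -(√3 / 2)⟩ := by
  apply Complex.ext
  · rw [vertex, bdryPt_re, show 2 * Real.pi * (((2 : Fin 3) : ℕ) / 3 : ℝ) = Real.pi / 3 + Real.pi by
      simp; ring, Real.cos_add_pi, Real.cos_pi_div_three]
    norm_num
  · rw [vertex, bdryPt_im, show 2 * Real.pi * (((2 : Fin 3) : ℕ) / 3 : ℝ) = Real.pi / 3 + Real.pi by
      simp; ring, Real.sin_add_pi, Real.sin_pi_div_three]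

theorem one_le_norm_vertex_sub {i j : Fin 3} (h : i ≠ j) :
    1 ≤ ‖(vertex i : ℂ) - (vertex j : ℂ)‖ := by
  have h3 : (1 : ℝ) ≤ √3 := Real.one_le_sqrt.mpr (by norm_num)
  have key : ∀ w : ℂ, (1 ≤ |w.re| ∨ 1 ≤ |w.im|) → 1 ≤ ‖w‖ := fun w hw =>
    hw.elim (fun h => h.trans (Complex.abs_re_le_norm w)) fun h => h.trans (Complex.abs_im_le_norm w)
  apply key
  fin_cases i <;> fin_cases j <;> simp at h <;>
    simp [coe_vertex_zero, coe_vertex_one, coe_vertex_two] <;> norm_num [abs_of_pos, abs_of_neg]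

/-! ### Schwarz–Christoffel maps -/

/-- The domain on which the Schwarz–Christoffel integrand is holomorphic: the plane minus the three
rays `{t v | t ≥ 1}`, `v` a marked point. -/
def slitDomain : Set ℂ := {z | ∀ j : Fin 3, 1 - z * conj (vertex j : ℂ) ∈ Complex.slitPlane}

/-- The Schwarz–Christoffel integrand `∏_j (1 - z / v_j) ^ (c_j - 1)` of a triangle with interior
angles `π c_j`. -/
def scDensity (c : Fin 3 → ℝ) (z : ℂ) : ℂ :=
  ∏ j : Fin 3, (1 - z * conj (vertex j : ℂ)) ^ ((c j : ℂ) - 1)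

/-- The Schwarz–Christoffel map, written as an integral along radii so that the formula also makes
sense at the marked points. -/
def scMap (c : Fin 3 → ℝ) (z : ℂ) : ℂ := ∫ t in (0 : ℝ)..1, z * scDensity c (t * z)

theorem isOpen_slitDomain : IsOpen slitDomain := by
  have : slitDomain = ⋂ j : Fin 3, (fun z : ℂ => 1 - z * conj (vertex j : ℂ)) ⁻¹'
      Complex.slitPlane := by
    ext z; simp [slitDomain]
  rw [this]
  exact isOpen_iInter_of_finite fun j => Complex.isOpen_slitPlane.preimage (by fun_prop)

theorem smul_mem_slitDomain {z : ℂ} (hz : z ∈ slitDomain) {t : ℝ} (h0 : 0 ≤ t) (h1 : t ≤ 1) :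
    (t : ℂ) * z ∈ slitDomain := by
  intro j
  have := Complex.starConvex_one_slitPlane (hz j) (a := 1 - t) (b := t) (by linarith) h0 (by ring)
  convert this using 1
  simp
  ring

theorem mem_slitDomain_of_norm_lt {z : ℂ} (hz : ‖z‖ < 1) : z ∈ slitDomain := by
  intro j
  left
  have h1 : (z * conj (vertex j : ℂ)).re ≤ ‖z * conj (vertex j : ℂ)‖ := Complex.re_le_norm _
  rw [norm_mul, RCLike.norm_conj, norm_vertex, mul_one] at h1
  rw [Complex.sub_re, Complex.one_re]
  linarith

theorem mem_slitDomain {z : ℂ} (hz : ‖z‖ ≤ 1) (hv : ∀ j : Fin 3, z ≠ vertex j) :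
    z ∈ slitDomain := by
  intro j
  set w := z * conj (vertex j : ℂ) with hw
  have hn : ‖w‖ ≤ 1 := by
    rw [hw, norm_mul, RCLike.norm_conj, norm_vertex, mul_one]
    exact hz
  have h1 : w.re ≤ ‖w‖ := Complex.re_le_norm _
  rcases lt_or_eq_of_le (h1.trans hn) with h | h
  · left
    rw [Complex.sub_re, Complex.one_re]
    linarith
  · right
    rw [Complex.sub_im, Complex.one_im]
    intro him
    have e : w = 1 := Complex.ext h (by simp at him ⊢; linarith)
    apply hv j
    calc z = z * ((vertex j : ℂ) * conj (vertex j : ℂ)) := by rw [vertex_mul_conj, mul_one]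
      _ = w * (vertex j : ℂ) := by rw [hw]; ring
      _ = vertex j := by rw [e, one_mul]

theorem differentiableOn_scDensity (c : Fin 3 → ℝ) :
    DifferentiableOn ℂ (scDensity c) slitDomain := by
  unfold scDensity
  refine DifferentiableOn.fun_finsetProd fun j _ => ?_
  refine DifferentiableOn.cpow ?_ (by fun_prop) fun z hz => hz j
  fun_prop

theorem norm_scDensity {c : Fin 3 → ℝ} {z : ℂ} (hz : z ∈ slitDomain) :
    ‖scDensity c z‖ = ∏ j : Fin 3, ‖1 - z * conj (vertex j : ℂ)‖ ^ (c j - 1) := by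
  rw [scDensity, norm_prod]
  refine Finset.prod_congr rfl fun j _ => ?_
  have := Complex.norm_cpow_of_ne_zero (Complex.slitPlane_ne_zero (hz j)) ((c j : ℂ) - 1)
  rw [this]
  simp

/-- Along a radius of the closed disk the integrand is dominated by an integrable function that
does not depend on the radius: at most one of the three factors can be small. -/
theorem norm_scDensity_le {c : Fin 3 → ℝ} (h0 : ∀ j, 0 < c j) (h1 : ∀ j, c j < 1) {z : ℂ}
    (hz : ‖z‖ ≤ 1) {t : ℝ} (ht0 : 0 ≤ t) (ht1 : t < 1) :
    ‖scDensity c (t * z)‖ ≤ 8 * ∑ j : Fin 3, (1 - t) ^ (c j - 1) := by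
  have hn : ‖(t : ℂ) * z‖ ≤ t := by
    rw [norm_mul, Complex.norm_real, Real.norm_of_nonneg ht0]
    exact mul_le_of_le_one_right ht0 hz
  rw [norm_scDensity (mem_slitDomain_of_norm_lt (hn.trans_lt ht1))]
  set x : Fin 3 → ℝ := fun j => ‖1 - t * z * conj (vertex j : ℂ)‖ with hx
  have hxv : ∀ j, x j = ‖(vertex j : ℂ) - t * z‖ := by
    intro j
    calc x j = ‖1 - t * z * conj (vertex j : ℂ)‖ * ‖(vertex j : ℂ)‖ := by
          rw [norm_vertex, mul_one]
      _ = ‖(vertex j : ℂ) - t * z‖ := by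
          rw [← norm_mul]
          congr 1
          linear_combination (-(t * z)) * (vertex_mul_conj j)
  have hxt : ∀ j, 1 - t ≤ x j := by
    intro j
    rw [hxv]
    have := norm_sub_norm_le (vertex j : ℂ) (t * z)
    rw [norm_vertex] at this
    linarith
  have hpos : ∀ j, 0 < x j := fun j => by linarith [hxt j]
  have hbig : ∀ j, 1 / 2 ≤ x j → x j ^ (c j - 1) ≤ 2 := by
    intro j hj
    calc x j ^ (c j - 1) ≤ (1 / 2 : ℝ) ^ (c j - 1) :=
          Real.rpow_le_rpow_of_nonpos (by norm_num) hj (by linarith [h1 j])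
      _ ≤ (1 / 2 : ℝ) ^ (-1 : ℝ) :=
          Real.rpow_le_rpow_of_exponent_ge (by norm_num) (by norm_num) (by linarith [h0 j])
      _ = 2 := by rw [Real.rpow_neg_one]; norm_num
  have hsmall : ∀ j, x j ^ (c j - 1) ≤ (1 - t) ^ (c j - 1) := fun j =>
    Real.rpow_le_rpow_of_nonpos (by linarith) (hxt j) (by linarith [h1 j])
  -- The marked points have mutual distance at least `1`.
  have hsep : ∀ i j, i ≠ j → 1 ≤ x i + x j := by
    intro i j hij
    rw [hxv, hxv]
    refine (one_le_norm_vertex_sub hij).trans ?_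
    rw [← norm_sub_rev (t * z) (vertex j : ℂ)]
    exact (norm_sub_le_norm_sub_add_norm_sub _ (t * z) _)
  have hge1 : ∀ j, 1 ≤ (1 - t) ^ (c j - 1) := fun j =>
    Real.one_le_rpow_of_pos_of_le_one_of_nonpos (by linarith) (by linarith) (by linarith [h1 j])
  have hnn : ∀ j, 0 ≤ x j ^ (c j - 1) := fun j => Real.rpow_nonneg (hpos j).le _
  change ∏ j, x j ^ (c j - 1) ≤ _
  rw [Fin.prod_univ_three, Fin.sum_univ_three]
  -- Two of the factors are at most `2`, and the third is at most the bound along the radius.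
  have main : ∀ a b d A : ℝ, 0 ≤ a → 0 ≤ b → 0 ≤ d → a ≤ 2 → b ≤ 2 → d ≤ A → a * b * d ≤ 4 * A := by
    intro a b d A ha hb hd ha2 hb2 hdA
    have : a * b ≤ 4 := by nlinarith
    calc a * b * d ≤ 4 * d := mul_le_mul_of_nonneg_right this hd
      _ ≤ 4 * A := by linarith
  have e01 := hsep 0 1 (by decide)
  have e02 := hsep 0 2 (by decide)
  have e12 := hsep 1 2 (by decide)
  by_cases k0 : x 0 < 1 / 2
  · have := main _ _ _ _ (hnn 1) (hnn 2) (hnn 0) (hbig 1 (by linarith)) (hbig 2 (by linarith))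
      (hsmall 0)
    nlinarith [hge1 0, hge1 1, hge1 2]
  by_cases k1 : x 1 < 1 / 2
  · have := main _ _ _ _ (hnn 0) (hnn 2) (hnn 1) (hbig 0 (by linarith)) (hbig 2 (by linarith))
      (hsmall 1)
    nlinarith [hge1 0, hge1 1, hge1 2]
  · have := main _ _ _ _ (hnn 0) (hnn 1) (hnn 2) (hbig 0 (by linarith)) (hbig 1 (by linarith))
      (hsmall 2)
    nlinarith [hge1 0, hge1 1, hge1 2]

theorem intervalIntegrable_scBound {c : Fin 3 → ℝ} (h0 : ∀ j, 0 < c j) :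
    IntervalIntegrable (fun t : ℝ => 8 * ∑ j : Fin 3, (1 - t) ^ (c j - 1))
      MeasureTheory.volume 0 1 := by
  refine IntervalIntegrable.const_mul ?_ _
  have : ∀ j : Fin 3, IntervalIntegrable (fun t : ℝ => (1 - t) ^ (c j - 1))
      MeasureTheory.volume 0 1 := by
    intro j
    have := (intervalIntegral.intervalIntegrable_rpow' (a := 0) (b := 1) (r := c j - 1)
      (by linarith [h0 j])).comp_sub_left 1
    simpa using this.symm
  have h := IntervalIntegrable.sum (μ := MeasureTheory.volume) (a := (0 : ℝ)) (b := 1) Finset.univ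
    (f := fun (j : Fin 3) (t : ℝ) => (1 - t) ^ (c j - 1)) fun j _ => this j
  refine h.congr fun t _ => ?_
  simp

theorem continuousOn_scIntegrand (c : Fin 3 → ℝ) {z : ℂ} (hz : ‖z‖ ≤ 1) :
    ContinuousOn (fun t : ℝ => z * scDensity c (t * z)) (Set.Ico 0 1) := by
  refine continuousOn_const.mul ?_
  refine (differentiableOn_scDensity c).continuousOn.comp (by fun_prop) fun t ht => ?_
  refine mem_slitDomain_of_norm_lt ?_
  rw [norm_mul, Complex.norm_real, Real.norm_of_nonneg ht.1]
  exact (mul_le_of_le_one_right ht.1 hz).trans_lt ht.2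

/-- The Schwarz–Christoffel map is continuous up to the boundary, marked points included. -/
theorem continuousOn_scMap {c : Fin 3 → ℝ} (h0 : ∀ j, 0 < c j) (h1 : ∀ j, c j < 1) :
    ContinuousOn (scMap c) (Metric.closedBall 0 1) := by
  intro z₀ hz₀
  have hne : ∀ᵐ t : ℝ, t ≠ 1 := by simp [MeasureTheory.ae_iff]
  refine intervalIntegral.continuousWithinAt_of_dominated_interval
    (bound := fun t : ℝ => 8 * ∑ j : Fin 3, (1 - t) ^ (c j - 1)) ?_ ?_
    (intervalIntegrable_scBound h0) ?_
  · filter_upwards [self_mem_nhdsWithin] with z hz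
    rw [mem_closedBall_zero_iff] at hz
    rw [Set.uIoc_of_le zero_le_one, ← MeasureTheory.restrict_Ioo_eq_restrict_Ioc]
    exact ((continuousOn_scIntegrand c hz).mono Set.Ioo_subset_Ico_self).aestronglyMeasurable
      measurableSet_Ioo
  · filter_upwards [self_mem_nhdsWithin] with z hz
    rw [mem_closedBall_zero_iff] at hz
    filter_upwards [hne] with t ht1 ht
    rw [Set.uIoc_of_le zero_le_one] at ht
    rw [norm_mul]
    refine (mul_le_of_le_one_left (norm_nonneg _) hz).trans ?_
    exact norm_scDensity_le h0 h1 hz ht.1.le (lt_of_le_of_ne ht.2 ht1)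
  · filter_upwards [hne] with t ht1 ht
    rw [Set.uIoc_of_le zero_le_one] at ht
    rw [mem_closedBall_zero_iff] at hz₀
    have hmem : (t : ℂ) * z₀ ∈ slitDomain := by
      refine mem_slitDomain_of_norm_lt ?_
      rw [norm_mul, Complex.norm_real, Real.norm_of_nonneg ht.1.le]
      exact (mul_le_of_le_one_right ht.1.le hz₀).trans_lt (lt_of_le_of_ne ht.2 ht1)
    have hc : ContinuousAt (scDensity c) (t * z₀) :=
      ((differentiableOn_scDensity c).differentiableAt
        (isOpen_slitDomain.mem_nhds hmem)).continuousAt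
    have : ContinuousAt (fun z : ℂ => z * scDensity c (t * z)) z₀ :=
      continuousAt_id.mul (ContinuousAt.comp (f := fun z : ℂ => (t : ℂ) * z) hc (by fun_prop))
    exact this.continuousWithinAt

/-- On the slit domain, which is star-shaped about the origin, the Schwarz–Christoffel map is a
primitive of its integrand. -/
theorem hasDerivAt_scMap (c : Fin 3 → ℝ) {z₀ : ℂ} (hz₀ : z₀ ∈ slitDomain) :
    HasDerivAt (scMap c) (scDensity c z₀) z₀ := by
  set g := scDensity c with hg
  have hd : ∀ z ∈ slitDomain, HasDerivAt g (deriv g z) z := fun z hz =>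
    ((differentiableOn_scDensity c).differentiableAt (isOpen_slitDomain.mem_nhds hz)).hasDerivAt
  have hgc : ContinuousOn g slitDomain := (differentiableOn_scDensity c).continuousOn
  have hdc : ContinuousOn (deriv g) slitDomain :=
    ((differentiableOn_scDensity c).deriv isOpen_slitDomain).continuousOn
  obtain ⟨r, hr, hball⟩ := Metric.isOpen_iff.mp isOpen_slitDomain z₀ hz₀
  set K := Metric.closedBall z₀ (r / 2) with hK
  have hKs : K ⊆ slitDomain := fun z hz => hball (by
    rw [hK, Metric.mem_closedBall] at hz
    rw [Metric.mem_ball]; linarith)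
  set F' : ℂ → ℝ → ℂ := fun z t => g (t * z) + z * (deriv g (t * z) * t) with hF'
  have hcont : ContinuousOn (fun q : ℝ × ℂ => F' q.2 q.1) (Set.Icc 0 1 ×ˢ K) := by
    have hm : Set.MapsTo (fun q : ℝ × ℂ => (q.1 : ℂ) * q.2) (Set.Icc 0 1 ×ˢ K) slitDomain :=
      fun q hq => smul_mem_slitDomain (hKs hq.2) hq.1.1 hq.1.2
    have hmc : ContinuousOn (fun q : ℝ × ℂ => (q.1 : ℂ) * q.2) (Set.Icc 0 1 ×ˢ K) := by fun_prop
    have c1 := hgc.comp hmc hm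
    have c2 := hdc.comp hmc hm
    exact c1.add (ContinuousOn.mul (by fun_prop) (c2.mul (by fun_prop)))
  obtain ⟨M, hM⟩ := (isCompact_Icc.prod (isCompact_closedBall z₀ (r / 2))).exists_bound_of_continuousOn
    hcont
  have hslice : ∀ z ∈ slitDomain, ContinuousOn (fun t : ℝ => z * g (t * z)) (Set.Icc 0 1) := by
    intro z hz
    exact continuousOn_const.mul (hgc.comp (by fun_prop) fun t ht =>
      smul_mem_slitDomain hz ht.1 ht.2)
  have hz₀K : z₀ ∈ K := Metric.mem_closedBall_self (by positivity)
  have hF'c : ContinuousOn (F' z₀) (Set.Icc 0 1) :=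
    hcont.comp (f := fun t : ℝ => (t, z₀)) (by fun_prop) fun t ht => ⟨ht, hz₀K⟩
  have h := intervalIntegral.hasDerivAt_integral_of_dominated_loc_of_deriv_le
    (μ := MeasureTheory.volume) (a := 0) (b := 1)
    (F := fun z (t : ℝ) => z * g (t * z)) (F' := F') (x₀ := z₀) (s := K) (bound := fun _ => M)
    (Metric.closedBall_mem_nhds _ (by positivity))
    (by
      filter_upwards [isOpen_slitDomain.mem_nhds hz₀] with z hz
      rw [Set.uIoc_of_le zero_le_one]
      exact ((hslice z hz).mono Set.Ioc_subset_Icc_self).aestronglyMeasurable measurableSet_Ioc)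
    (ContinuousOn.intervalIntegrable_of_Icc zero_le_one (hslice z₀ hz₀))
    (by
      rw [Set.uIoc_of_le zero_le_one]
      exact (hF'c.mono Set.Ioc_subset_Icc_self).aestronglyMeasurable measurableSet_Ioc)
    (by
      refine Eventually.of_forall fun t ht z hz => ?_
      rw [Set.uIoc_of_le zero_le_one] at ht
      exact hM (t, z) ⟨⟨ht.1.le, ht.2⟩, hz⟩)
    intervalIntegrable_const
    (by
      refine Eventually.of_forall fun t ht z hz => ?_
      rw [Set.uIoc_of_le zero_le_one] at ht
      have h1 := hd _ (smul_mem_slitDomain (hKs hz) ht.1.le ht.2)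
      have h2 : HasDerivAt (fun z : ℂ => (t : ℂ) * z) t z := by
        simpa using (hasDerivAt_id z).const_mul (t : ℂ)
      have h3 := (hasDerivAt_id' z).fun_mul (h1.comp z h2)
      rw [one_mul] at h3
      exact h3)
  -- The derivative of the integrand in `z` is the derivative of `t g(t z)` in `t`.
  have hftc : ∫ t in (0 : ℝ)..1, F' z₀ t = g z₀ := by
    have hder : ∀ t ∈ Set.uIcc (0 : ℝ) 1,
        HasDerivAt (fun t : ℝ => (t : ℂ) * g (t * z₀)) (F' z₀ t) t := by
      intro t ht
      rw [Set.uIcc_of_le zero_le_one] at ht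
      have h1 := hd _ (smul_mem_slitDomain hz₀ ht.1 ht.2)
      have h2 : HasDerivAt (fun w : ℂ => w * z₀) z₀ (t : ℂ) := by
        simpa using (hasDerivAt_id (t : ℂ)).mul_const z₀
      have h3 := ((hasDerivAt_id' (t : ℂ)).fun_mul (h1.comp (t : ℂ) h2)).comp_ofReal
      refine h3.congr_deriv ?_
      change 1 * g (t * z₀) + t * (deriv g (t * z₀) * z₀) = g (t * z₀) + z₀ * (deriv g (t * z₀) * t)
      ring
    rw [intervalIntegral.integral_eq_sub_of_hasDerivAt hder
      (ContinuousOn.intervalIntegrable_of_Icc zero_le_one hF'c)]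
    simp
  rw [← hftc]
  exact h.2

theorem analyticAt_scMap (c : Fin 3 → ℝ) {z : ℂ} (hz : z ∈ slitDomain) :
    AnalyticAt ℂ (scMap c) z := by
  have : DifferentiableOn ℂ (scMap c) slitDomain := fun w hw =>
    (hasDerivAt_scMap c hw).differentiableAt.differentiableWithinAt
  exact this.analyticAt (isOpen_slitDomain.mem_nhds hz)

/-! ### Boundary values of Schwarz–Christoffel maps -/

theorem one_sub_exp_eq (s : ℝ) :
    1 - Complex.exp (2 * Real.pi * s * Complex.I) =
      ((2 * Real.sin (Real.pi * s) : ℝ) : ℂ) *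
        Complex.exp ((Real.pi * (s - 1 / 2) : ℝ) * Complex.I) := by
  have h1 : Complex.exp ((Real.pi * (s - 1 / 2) : ℝ) * Complex.I) =
      Complex.exp (Real.pi * s * Complex.I) * -Complex.I := by
    rw [← Complex.exp_neg_pi_div_two_mul_I, ← Complex.exp_add]
    congr 1
    push_cast
    ring
  have h2 : Complex.exp (2 * Real.pi * s * Complex.I) =
      Complex.exp (Real.pi * s * Complex.I) * Complex.exp (Real.pi * s * Complex.I) := by
    rw [← Complex.exp_add]
    congr 1
    ring
  have h3 : Complex.exp (-(Real.pi * s) * Complex.I) * Complex.exp (Real.pi * s * Complex.I) = 1 := by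
    rw [← Complex.exp_add]
    simp
  rw [h1, h2]
  push_cast
  rw [Complex.sin]
  linear_combination -h3 +
    (Complex.exp (-(Real.pi * s) * Complex.I) * Complex.exp (Real.pi * s * Complex.I) -
      Complex.exp (Real.pi * s * Complex.I) * Complex.exp (Real.pi * s * Complex.I)) *
      Complex.I_mul_I

/-- The argument of `1 - exp (2 π i s)` is `π (s - 1 / 2)` for `0 < s < 1`, which fixes the branch of
its powers. -/
theorem one_sub_exp_cpow {s : ℝ} (h0 : 0 < s) (h1 : s < 1) (c : ℝ) :
    (1 - Complex.exp (2 * Real.pi * s * Complex.I)) ^ ((c : ℂ) - 1) =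
      (((2 * Real.sin (Real.pi * s)) ^ (c - 1) : ℝ) : ℂ) *
        Complex.exp ((Real.pi * ((c - 1) * (s - 1 / 2)) : ℝ) * Complex.I) := by
  have hpi := Real.pi_pos
  have hsin : 0 < 2 * Real.sin (Real.pi * s) := by
    have := Real.sin_pos_of_pos_of_lt_pi (x := Real.pi * s) (by positivity) (by nlinarith)
    linarith
  rw [one_sub_exp_eq, Complex.cpow_def_of_ne_zero
    (mul_ne_zero (Complex.ofReal_ne_zero.mpr hsin.ne') (Complex.exp_ne_zero _)),
    Complex.log_ofReal_mul hsin (Complex.exp_ne_zero _), Complex.log_exp,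
    Real.rpow_def_of_pos hsin, Complex.ofReal_exp, ← Complex.exp_add]
  · congr 1
    push_cast
    ring
  · simp
    nlinarith
  · simp
    nlinarith

theorem bdryPt_mul_conj_vertex (s : ℝ) (j : Fin 3) (n : ℤ) :
    (bdryPt s : ℂ) * conj (vertex j : ℂ) =
      Complex.exp (2 * Real.pi * ((s - (j : ℝ) / 3 + n : ℝ) : ℂ) * Complex.I) := by
  rw [vertex, conj_bdryPt, coe_bdryPt, ← Complex.exp_add]
  rw [Complex.exp_eq_exp_iff_exists_int]
  refine ⟨-n, ?_⟩
  push_cast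
  ring

theorem hasDerivAt_coe_bdryPt (s : ℝ) :
    HasDerivAt (fun s : ℝ => (bdryPt s : ℂ)) (2 * Real.pi * Complex.I * (bdryPt s : ℂ)) s := by
  have h : HasDerivAt (fun w : ℂ => 2 * Real.pi * w * Complex.I) (2 * Real.pi * Complex.I) (s : ℂ) := by
    simpa using ((hasDerivAt_id (s : ℂ)).const_mul (2 * Real.pi : ℂ)).mul_const Complex.I
  have h2 := h.cexp.comp_ofReal
  refine h2.congr_deriv ?_
  rw [coe_bdryPt]
  ring

/-- On each boundary arc the tangent direction of the Schwarz–Christoffel map is constant: the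
rotation of the tangent of the circle cancels against the arguments of the three factors. The
integers `n j` record the branches of the arguments on the arc. -/
theorem hasDerivAt_scMap_bdryPt {c : Fin 3 → ℝ} (hc : ∑ j, c j = 1) (n : Fin 3 → ℤ) {s : ℝ}
    (hn0 : ∀ j : Fin 3, 0 < s - (j : ℝ) / 3 + n j) (hn1 : ∀ j : Fin 3, s - (j : ℝ) / 3 + n j < 1) :
    ∃ ρ : ℝ, 0 < ρ ∧ HasDerivAt (fun s : ℝ => scMap c (bdryPt s))
      (ρ * Complex.exp ((3 * Real.pi / 2 + Real.pi * ∑ j : Fin 3, (c j - 1) * (n j - (j : ℝ) / 3) : ℝ)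
        * Complex.I)) s := by
  have hpi := Real.pi_pos
  have hsin : ∀ j : Fin 3, 0 < 2 * Real.sin (Real.pi * (s - (j : ℝ) / 3 + n j)) := by
    intro j
    have := Real.sin_pos_of_pos_of_lt_pi (x := Real.pi * (s - (j : ℝ) / 3 + n j))
      (mul_pos hpi (hn0 j)) (by nlinarith [hn1 j])
    linarith
  have hmem : (bdryPt s : ℂ) ∈ slitDomain := by
    refine mem_slitDomain (norm_bdryPt s).le fun j hj => ?_
    have h1 := bdryPt_mul_conj_vertex s j (n j)
    rw [hj, vertex_mul_conj] at h1
    have h2 := one_sub_exp_eq (s - (j : ℝ) / 3 + n j)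
    rw [← h1, sub_self] at h2
    exact mul_ne_zero (Complex.ofReal_ne_zero.mpr (hsin j).ne') (Complex.exp_ne_zero _) h2.symm
  refine ⟨2 * Real.pi * ∏ j : Fin 3, (2 * Real.sin (Real.pi * (s - (j : ℝ) / 3 + n j))) ^ (c j - 1),
    mul_pos (by positivity) (Finset.prod_pos fun j _ => Real.rpow_pos_of_pos (hsin j) _), ?_⟩
  have h := (hasDerivAt_scMap c hmem).comp s (hasDerivAt_coe_bdryPt s)
  refine h.congr_deriv ?_
  have hd : scDensity c (bdryPt s : ℂ) =
      ((∏ j : Fin 3, (2 * Real.sin (Real.pi * (s - (j : ℝ) / 3 + n j))) ^ (c j - 1) : ℝ) : ℂ) *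
        Complex.exp ((Real.pi * ∑ j : Fin 3, (c j - 1) * (s - (j : ℝ) / 3 + n j - 1 / 2) : ℝ)
          * Complex.I) := by
    rw [scDensity, Finset.prod_congr rfl fun j _ => by
      rw [bdryPt_mul_conj_vertex s j (n j), one_sub_exp_cpow (hn0 j) (hn1 j)],
      Finset.prod_mul_distrib, ← Complex.exp_sum, Complex.ofReal_prod]
    congr 2
    push_cast
    rw [← Finset.sum_mul, Finset.mul_sum]
  have hI : Complex.exp ((Real.pi / 2 : ℝ) * Complex.I) = Complex.I := by
    push_cast
    exact Complex.exp_pi_div_two_mul_I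
  rw [hd, coe_bdryPt]
  have e : Complex.exp ((3 * Real.pi / 2 + Real.pi * ∑ j : Fin 3, (c j - 1) * (n j - (j : ℝ) / 3) : ℝ)
        * Complex.I) = Complex.I * Complex.exp (2 * Real.pi * s * Complex.I) *
        Complex.exp ((Real.pi * ∑ j : Fin 3, (c j - 1) * (s - (j : ℝ) / 3 + n j - 1 / 2) : ℝ)
          * Complex.I) := by
    nth_rewrite 2 [← hI]
    rw [← Complex.exp_add, ← Complex.exp_add]
    congr 1
    -- Since the exponents `c j - 1` add up to `-2`, the dependence on `s` cancels.
    have hs : ∑ j : Fin 3, (c j - 1) * (s - (j : ℝ) / 3 + n j - 1 / 2) =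
        ∑ j : Fin 3, (c j - 1) * (n j - (j : ℝ) / 3) - 2 * (s - 1 / 2) := by
      simp only [Fin.sum_univ_three] at hc ⊢
      linear_combination (s - 1 / 2) * hc
    rw [hs]
    push_cast
    ring
  rw [e]
  push_cast
  ring

/-- The interior angles, divided by `π`, of a triangle with sides of slopes `0`, `-p`, `-q`. -/
def triAngles (p q : ℝ) : Fin 3 → ℝ :=
  ![1 - Real.arctan q / Real.pi, Real.arctan p / Real.pi, (Real.arctan q - Real.arctan p) / Real.pi]

theorem triAngles_pos {p q : ℝ} (hp : 0 < p) (hpq : p < q) (j : Fin 3) : 0 < triAngles p q j := by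
  have hpi := Real.pi_pos
  have h1 := Real.arctan_pos.mpr hp
  have h2 := Real.arctan_strictMono hpq
  have h3 := Real.arctan_lt_pi_div_two q
  fin_cases j <;> simp [triAngles]
  · rw [div_lt_one hpi]; linarith
  · positivity
  · exact div_pos (by linarith) hpi

theorem sum_triAngles (p q : ℝ) : ∑ j, triAngles p q j = 1 := by
  simp [Fin.sum_univ_three, triAngles]
  ring

theorem triAngles_lt_one {p q : ℝ} (hp : 0 < p) (hpq : p < q) (j : Fin 3) : triAngles p q j < 1 := by
  have h := sum_triAngles p q
  have hpos := triAngles_pos hp hpq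
  rw [Fin.sum_univ_three] at h
  fin_cases j <;> simp only [Fin.zero_eta, Fin.mk_one, Fin.reduceFinMk] <;>
    linarith [hpos 0, hpos 1, hpos 2]

theorem exp_neg_arctan (x : ℝ) : Complex.exp ((-Real.arctan x : ℝ) * Complex.I) =
    (Real.cos (Real.arctan x) : ℂ) * (1 - x * Complex.I) := by
  have h : Real.sin (Real.arctan x) = x * Real.cos (Real.arctan x) := by
    have h1 := Real.tan_arctan x
    rw [Real.tan_eq_sin_div_cos, div_eq_iff (Real.cos_arctan_pos x).ne'] at h1
    exact h1
  rw [Complex.exp_mul_I, ← Complex.ofReal_cos, ← Complex.ofReal_sin, Real.cos_neg, Real.sin_neg, h]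
  push_cast
  ring

/-- The Schwarz–Christoffel map onto a triangle with sides of slopes `0`, `-p`, `-q`, rotated so that
the side between the first two marked points is horizontal. -/
def modelMap (p q : ℝ) (z : ℂ) : ℂ :=
  Complex.exp (-((3 * Real.pi / 2 + Real.pi * ((triAngles p q 1 - 1) * (2 / 3)
    + (triAngles p q 2 - 1) * (1 / 3)) : ℝ) * Complex.I)) * scMap (triAngles p q) z

theorem continuousOn_modelMap {p q : ℝ} (hp : 0 < p) (hpq : p < q) :
    ContinuousOn (modelMap p q) (Metric.closedBall 0 1) :=
  continuousOn_const.mul (continuousOn_scMap (triAngles_pos hp hpq) (triAngles_lt_one hp hpq))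

theorem analyticAt_modelMap (p q : ℝ) {z : ℂ} (hz : z ∈ slitDomain) :
    AnalyticAt ℂ (modelMap p q) z :=
  analyticAt_const.mul (analyticAt_scMap _ hz)

/-- The direction of the tangent of the model triangle on an arc, in terms of the branch data `n`. -/
theorem hasDerivAt_modelMap_arc (p q : ℝ) (n : Fin 3 → ℤ) {s : ℝ}
    (hn0 : ∀ j : Fin 3, 0 < s - (j : ℝ) / 3 + n j) (hn1 : ∀ j : Fin 3, s - (j : ℝ) / 3 + n j < 1) :
    ∃ ρ : ℝ, 0 < ρ ∧ HasDerivAt (fun s : ℝ => modelMap p q (bdryPt s))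
      (ρ * Complex.exp ((Real.pi * ((triAngles p q 0 - 1) * n 0 + (triAngles p q 1 - 1) * (n 1 - 1)
        + (triAngles p q 2 - 1) * (n 2 - 1)) : ℝ) * Complex.I)) s := by
  obtain ⟨ρ, hρ, h⟩ := hasDerivAt_scMap_bdryPt (sum_triAngles p q) n hn0 hn1
  refine ⟨ρ, hρ, (h.const_mul _).congr_deriv ?_⟩
  rw [mul_left_comm, ← Complex.exp_add]
  congr 2
  simp [Fin.sum_univ_three]
  ring

theorem hasDerivAt_modelMap_arc_zero (p q : ℝ) {s : ℝ} (h0 : 0 < s) (h1 : s < 1 / 3) :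
    ∃ ρ : ℝ, 0 < ρ ∧ HasDerivAt (fun s : ℝ => modelMap p q (bdryPt s)) (ρ : ℂ) s := by
  obtain ⟨ρ, hρ, h⟩ := hasDerivAt_modelMap_arc p q ![0, 1, 1] (s := s)
    (by intro j; fin_cases j <;> simp <;> linarith) (by intro j; fin_cases j <;> simp <;> linarith)
  refine ⟨ρ, hρ, h.congr_deriv ?_⟩
  simp

theorem hasDerivAt_modelMap_arc_one (p q : ℝ) {s : ℝ} (h0 : 1 / 3 < s) (h1 : s < 2 / 3) :
    ∃ ρ : ℝ, 0 < ρ ∧ HasDerivAt (fun s : ℝ => modelMap p q (bdryPt s))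
      (-ρ * (1 - p * Complex.I)) s := by
  obtain ⟨ρ, hρ, h⟩ := hasDerivAt_modelMap_arc p q ![0, 0, 1] (s := s)
    (by intro j; fin_cases j <;> simp <;> linarith) (by intro j; fin_cases j <;> simp <;> linarith)
  refine ⟨ρ * Real.cos (Real.arctan p), mul_pos hρ (Real.cos_arctan_pos p), h.congr_deriv ?_⟩
  have e : (Real.pi * ((triAngles p q 0 - 1) * (![0, 0, 1] : Fin 3 → ℤ) 0
      + (triAngles p q 1 - 1) * ((![0, 0, 1] : Fin 3 → ℤ) 1 - 1)
      + (triAngles p q 2 - 1) * ((![0, 0, 1] : Fin 3 → ℤ) 2 - 1)) : ℝ) =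
      -Real.arctan p + Real.pi := by
    simp [triAngles]
    field_simp
    ring
  rw [e, Complex.ofReal_add, add_mul, Complex.exp_add, Complex.exp_pi_mul_I, exp_neg_arctan]
  push_cast
  ring

theorem hasDerivAt_modelMap_arc_two (p q : ℝ) {s : ℝ} (h0 : 2 / 3 < s) (h1 : s < 1) :
    ∃ ρ : ℝ, 0 < ρ ∧ HasDerivAt (fun s : ℝ => modelMap p q (bdryPt s))
      (ρ * (1 - q * Complex.I)) s := by
  obtain ⟨ρ, hρ, h⟩ := hasDerivAt_modelMap_arc p q ![0, 0, 0] (s := s)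
    (by intro j; fin_cases j <;> simp <;> linarith) (by intro j; fin_cases j <;> simp <;> linarith)
  refine ⟨ρ * Real.cos (Real.arctan q), mul_pos hρ (Real.cos_arctan_pos q), h.congr_deriv ?_⟩
  have e : (Real.pi * ((triAngles p q 0 - 1) * (![0, 0, 0] : Fin 3 → ℤ) 0
      + (triAngles p q 1 - 1) * ((![0, 0, 0] : Fin 3 → ℤ) 1 - 1)
      + (triAngles p q 2 - 1) * ((![0, 0, 0] : Fin 3 → ℤ) 2 - 1)) : ℝ) =
      -Real.arctan q + Real.pi + Real.pi := by
    simp [triAngles]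
    field_simp
    ring
  rw [e, Complex.ofReal_add, Complex.ofReal_add, add_mul, add_mul, Complex.exp_add, Complex.exp_add,
    Complex.exp_pi_mul_I, exp_neg_arctan]
  push_cast
  ring

/-- A function of a real variable whose derivative vanishes inside an interval is constant on it. -/
theorem eq_left_of_hasDerivAt_zero {f : ℝ → ℝ} {a b : ℝ} (hc : ContinuousOn f (Set.Icc a b))
    (hd : ∀ s ∈ Set.Ioo a b, HasDerivAt f 0 s) : ∀ s ∈ Set.Icc a b, f s = f a := by
  intro s hs
  rcases eq_or_lt_of_le hs.1 with h | h
  · rw [h]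
  · obtain ⟨x, _, hx⟩ := exists_hasDerivAt_eq_slope f (fun _ => 0) h
      (hc.mono (Set.Icc_subset_Icc_right hs.2)) fun x hx => hd x ⟨hx.1, hx.2.trans_le hs.2⟩
    have := (eq_div_iff (sub_pos.mpr h).ne').mp hx
    linarith

theorem continuous_modelMap_bdryPt {p q : ℝ} (hp : 0 < p) (hpq : p < q) :
    Continuous fun s : ℝ => modelMap p q (bdryPt s) := by
  refine (continuousOn_modelMap hp hpq).comp_continuous
    (continuous_subtype_val.comp continuous_bdryPt) fun s => (bdryPt s).2

theorem hasDerivAt_re {f : ℝ → ℂ} {d : ℂ} {s : ℝ} (h : HasDerivAt f d s) :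
    HasDerivAt (fun s => (f s).re) d.re s :=
  (Complex.reCLM.hasFDerivAt.comp_hasDerivAt s h)

theorem hasDerivAt_im {f : ℝ → ℂ} {d : ℂ} {s : ℝ} (h : HasDerivAt f d s) :
    HasDerivAt (fun s => (f s).im) d.im s :=
  (Complex.imCLM.hasFDerivAt.comp_hasDerivAt s h)

theorem strictMonoOn_re_modelMap_zero {p q : ℝ} (hp : 0 < p) (hpq : p < q) :
    StrictMonoOn (fun s : ℝ => (modelMap p q (bdryPt s)).re) (Set.Icc 0 (1 / 3)) := by
  refine strictMonoOn_of_deriv_pos (convex_Icc _ _)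
    (Complex.continuous_re.comp (continuous_modelMap_bdryPt hp hpq)).continuousOn fun s hs => ?_
  rw [interior_Icc] at hs
  obtain ⟨ρ, hρ, h⟩ := hasDerivAt_modelMap_arc_zero p q hs.1 hs.2
  rw [(hasDerivAt_re h).deriv]
  simpa using hρ

theorem strictAntiOn_re_modelMap_one {p q : ℝ} (hp : 0 < p) (hpq : p < q) :
    StrictAntiOn (fun s : ℝ => (modelMap p q (bdryPt s)).re) (Set.Icc (1 / 3) (2 / 3)) := by
  refine strictAntiOn_of_deriv_neg (convex_Icc _ _)
    (Complex.continuous_re.comp (continuous_modelMap_bdryPt hp hpq)).continuousOn fun s hs => ?_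
  rw [interior_Icc] at hs
  obtain ⟨ρ, hρ, h⟩ := hasDerivAt_modelMap_arc_one p q hs.1 hs.2
  rw [(hasDerivAt_re h).deriv]
  simpa using hρ

theorem strictMonoOn_re_modelMap_two {p q : ℝ} (hp : 0 < p) (hpq : p < q) :
    StrictMonoOn (fun s : ℝ => (modelMap p q (bdryPt s)).re) (Set.Icc (2 / 3) 1) := by
  refine strictMonoOn_of_deriv_pos (convex_Icc _ _)
    (Complex.continuous_re.comp (continuous_modelMap_bdryPt hp hpq)).continuousOn fun s hs => ?_
  rw [interior_Icc] at hs
  obtain ⟨ρ, hρ, h⟩ := hasDerivAt_modelMap_arc_two p q hs.1 hs.2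
  rw [(hasDerivAt_re h).deriv]
  simpa using hρ

theorem im_modelMap_zero {p q : ℝ} (hp : 0 < p) (hpq : p < q) {s : ℝ} (hs : s ∈ Set.Icc 0 (1 / 3)) :
    (modelMap p q (bdryPt s)).im = (modelMap p q (bdryPt 0)).im := by
  refine eq_left_of_hasDerivAt_zero (f := fun s : ℝ => (modelMap p q (bdryPt s)).im)
    (Complex.continuous_im.comp (continuous_modelMap_bdryPt hp hpq)).continuousOn
    (fun s hs => ?_) s hs
  obtain ⟨ρ, hρ, h⟩ := hasDerivAt_modelMap_arc_zero p q hs.1 hs.2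
  simpa using hasDerivAt_im h

theorem im_add_re_modelMap_one {p q : ℝ} (hp : 0 < p) (hpq : p < q) {s : ℝ}
    (hs : s ∈ Set.Icc (1 / 3) (2 / 3)) :
    (modelMap p q (bdryPt s)).im + p * (modelMap p q (bdryPt s)).re =
      (modelMap p q (bdryPt (1 / 3))).im + p * (modelMap p q (bdryPt (1 / 3))).re := by
  have hc := continuous_modelMap_bdryPt hp hpq
  refine eq_left_of_hasDerivAt_zero
    (f := fun s : ℝ => (modelMap p q (bdryPt s)).im + p * (modelMap p q (bdryPt s)).re)
    ((Complex.continuous_im.comp hc).add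
      (continuous_const.mul (Complex.continuous_re.comp hc))).continuousOn (fun s hs => ?_) s hs
  obtain ⟨ρ, hρ, h⟩ := hasDerivAt_modelMap_arc_one p q hs.1 hs.2
  refine ((hasDerivAt_im h).add ((hasDerivAt_re h).const_mul p)).congr_deriv ?_
  simp
  ring

theorem im_add_re_modelMap_two {p q : ℝ} (hp : 0 < p) (hpq : p < q) {s : ℝ}
    (hs : s ∈ Set.Icc (2 / 3) 1) :
    (modelMap p q (bdryPt s)).im + q * (modelMap p q (bdryPt s)).re =
      (modelMap p q (bdryPt (2 / 3))).im + q * (modelMap p q (bdryPt (2 / 3))).re := by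
  have hc := continuous_modelMap_bdryPt hp hpq
  refine eq_left_of_hasDerivAt_zero
    (f := fun s : ℝ => (modelMap p q (bdryPt s)).im + q * (modelMap p q (bdryPt s)).re)
    ((Complex.continuous_im.comp hc).add
      (continuous_const.mul (Complex.continuous_re.comp hc))).continuousOn (fun s hs => ?_) s hs
  obtain ⟨ρ, hρ, h⟩ := hasDerivAt_modelMap_arc_two p q hs.1 hs.2
  refine ((hasDerivAt_im h).add ((hasDerivAt_re h).const_mul q)).congr_deriv ?_
  simp
  ring

/-! ### Uniqueness of holomorphic triangles -/

/-- A function holomorphic in the disk and continuous up to the boundary whose boundary values lie on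
finitely many lines through the origin is constant: otherwise its image would be open and contain a
point off the lines, and the ray through that point would leave the compact image at an interior
point. -/
theorem eq_const_of_boundary_subset_lines {ι : Type*} [Finite ι] [Nonempty ι] (k : ι → ℝ)
    {f : ℂ → ℂ}
    (hc : ContinuousOn f (Metric.closedBall 0 1)) (hd : DifferentiableOn ℂ f (Metric.ball 0 1))
    (hb : ∀ z : ℂ, ‖z‖ = 1 → ∃ j, (f z).im + k j * (f z).re = 0) :
    ∃ a, ∀ z ∈ Metric.closedBall (0 : ℂ) 1, f z = a := by
  have han : AnalyticOnNhd ℂ f (Metric.ball 0 1) := hd.analyticOnNhd Metric.isOpen_ball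
  rcases han.is_constant_or_isOpen (convex_ball 0 1).isPreconnected with ⟨a, ha⟩ | hopen
  · refine ⟨a, ?_⟩
    have h : Set.EqOn f (fun _ => a) (Metric.ball 0 1) := ha
    refine h.of_subset_closure hc continuousOn_const Metric.ball_subset_closedBall ?_
    rw [closure_ball _ one_ne_zero]
  · exfalso
    have hO := hopen _ subset_rfl Metric.isOpen_ball
    set O := f '' Metric.ball 0 1 with hOdef
    have h0O : f 0 ∈ O := ⟨0, Metric.mem_ball_self one_pos, rfl⟩
    obtain ⟨r, hr, hrO⟩ := Metric.isOpen_iff.mp hO _ h0O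
    -- A vertical translate of `f 0` that stays in the open image and avoids the lines.
    obtain ⟨τ, hτ, hτn⟩ := (Set.Ioo_infinite hr).exists_notMem_finite
      (Set.finite_range fun j => -((f 0).im + k j * (f 0).re))
    set q : ℂ := f 0 + τ * Complex.I with hq
    have hqO : q ∈ O := by
      refine hrO ?_
      rw [Metric.mem_ball, dist_eq_norm, hq, add_sub_cancel_left, norm_mul, Complex.norm_I, mul_one,
        Complex.norm_real, Real.norm_of_nonneg hτ.1.le]
      exact hτ.2
    have hql : ∀ j, q.im + k j * q.re ≠ 0 := by
      intro j hj
      refine hτn ⟨j, ?_⟩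
      simp [hq] at hj ⊢
      linarith
    have hq0 : q ≠ 0 := by
      intro h
      obtain ⟨j⟩ := ‹Nonempty ι›
      exact hql j (by simp [h])
    set K := f '' Metric.closedBall 0 1 with hK
    have hOK : O ⊆ K := Set.image_mono Metric.ball_subset_closedBall
    have hKc : IsCompact K := (isCompact_closedBall 0 1).image_of_continuousOn hc
    obtain ⟨M, hM⟩ := hKc.isBounded.exists_norm_le
    -- The last point of the ray through `q` that belongs to the image.
    set A : Set ℝ := Set.Icc 1 (M / ‖q‖) ∩ (fun t : ℝ => (t : ℂ) * q) ⁻¹' K with hA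
    have hmemA : ∀ t : ℝ, 1 ≤ t → (t : ℂ) * q ∈ K → t ∈ A := by
      intro t ht htK
      refine ⟨⟨ht, ?_⟩, htK⟩
      rw [le_div_iff₀ (norm_pos_iff.mpr hq0)]
      have := hM _ htK
      rwa [norm_mul, Complex.norm_real, Real.norm_of_nonneg (by linarith)] at this
    have hAc : IsCompact A := isCompact_Icc.inter_right
      (hKc.isClosed.preimage (by fun_prop))
    have hAne : A.Nonempty := ⟨1, hmemA 1 le_rfl (by simpa using hOK hqO)⟩
    obtain ⟨t, htA, htmax⟩ := hAc.exists_isMaxOn hAne continuousOn_id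
    obtain ⟨z, hz, hfz⟩ := htA.2
    have ht1 : 1 ≤ t := htA.1.1
    have hzball : z ∈ Metric.ball (0 : ℂ) 1 := by
      rw [mem_ball_zero_iff]
      rw [mem_closedBall_zero_iff] at hz
      refine lt_of_le_of_ne hz fun h1 => ?_
      obtain ⟨j, hj⟩ := hb z h1
      rw [hfz] at hj
      refine hql j ?_
      have : t * (q.im + k j * q.re) = 0 := by
        simp at hj
        linarith
      rcases mul_eq_zero.mp this with h | h
      · linarith
      · exact h
    have htO : (t : ℂ) * q ∈ O := ⟨z, hzball, hfz⟩
    have hcont : ContinuousAt (fun t : ℝ => (t : ℂ) * q) t := by fun_prop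
    have hev : ∀ᶠ t' : ℝ in 𝓝 t, (t' : ℂ) * q ∈ O := hcont (hO.mem_nhds htO)
    obtain ⟨t', ht'O, ht'⟩ :=
      ((hev.filter_mono nhdsWithin_le_nhds).and (self_mem_nhdsWithin (s := Set.Ioi t))).exists
    have := htmax (hmemA t' (ht1.trans (le_of_lt ht')) (hOK ht'O))
    simp at this
    exact absurd ht' (not_lt.mpr this)

/-! ### Lifts to the universal covering -/

theorem coe_eq_coe_iff {x y : ℝ} : (x : UnitAddCircle) = y ↔ ∃ n : ℤ, x = y + n := by
  rw [← sub_eq_zero, ← AddCircle.coe_sub, AddCircle.coe_eq_zero_iff]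
  refine exists_congr fun n => ?_
  rw [zsmul_one]
  constructor <;> intro h <;> linarith

theorem cover_eq_cover_iff {w w' : ℂ} :
    cover w = cover w' ↔ (∃ n : ℤ, w.re = w'.re + n) ∧ ∃ n : ℤ, w.im = w'.im + n := by
  rw [cover, cover, Prod.mk.injEq, coe_eq_coe_iff, coe_eq_coe_iff]

theorem cover_mem_lag_iff {w : ℂ} {m : ℤ} : cover w ∈ lag m ↔ ∃ n : ℤ, w.im + m * w.re = n := by
  constructor
  · rintro ⟨s, hs⟩
    obtain ⟨⟨a, ha⟩, b, hb⟩ := cover_eq_cover_iff.mp hs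
    refine ⟨-b - m * a, ?_⟩
    dsimp only at ha hb
    push_cast
    linear_combination -hb - (m : ℝ) * ha
  · rintro ⟨n, hn⟩
    refine ⟨w.re, cover_eq_cover_iff.mpr ⟨⟨0, by simp⟩, -n, ?_⟩⟩
    push_cast
    linarith

/-- A point of `L_(m)` is determined by its first coordinate. -/
theorem exists_lift_mem_lag {x : Torus} {m : ℤ} (hx : x ∈ lag m) {X : ℝ}
    (hX : (X : UnitAddCircle) = x.1) : x = cover ⟨X, -(m * X)⟩ := by
  obtain ⟨s, rfl⟩ := hx
  obtain ⟨n, hn⟩ := coe_eq_coe_iff.mp hX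
  rw [cover_eq_cover_iff]
  refine ⟨⟨-n, ?_⟩, m * n, ?_⟩
  · push_cast
    linarith
  · push_cast
    rw [hn]
    ring

theorem eq_zero_of_mem_lattice_of_norm_lt_one {w : ℂ} (h : cover w = cover 0) (hw : ‖w‖ < 1) :
    w = 0 := by
  obtain ⟨⟨a, ha⟩, b, hb⟩ := cover_eq_cover_iff.mp h
  rw [Complex.zero_re, zero_add] at ha
  rw [Complex.zero_im, zero_add] at hb
  have h1 := (Complex.abs_re_le_norm w).trans_lt hw
  have h2 := (Complex.abs_im_le_norm w).trans_lt hw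
  rw [ha] at h1
  rw [hb] at h2
  have h3 : a = 0 := Int.abs_lt_one_iff.mp (by exact_mod_cast h1)
  have h4 : b = 0 := Int.abs_lt_one_iff.mp (by exact_mod_cast h2)
  exact Complex.ext (by simp [ha, h3]) (by simp [hb, h4])

instance : SimplyConnectedSpace Disk := by
  have : ContractibleSpace Disk := (convex_closedBall (0 : ℂ) 1).contractibleSpace
    ⟨0, Metric.mem_closedBall_self zero_le_one⟩
  infer_instance

instance : LocallyPathConnectedSpace Disk := (convex_closedBall (0 : ℂ) 1).locallyPathConnectedSpace

theorem exists_lift (u : C(Disk, Torus)) {w₀ : ℂ} (h : cover w₀ = u (vertex 0)) :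
    ∃ F : C(Disk, ℂ), F (vertex 0) = w₀ ∧ ∀ w, cover (F w) = u w := by
  obtain ⟨F₁, ⟨h1, h2⟩, -⟩ := (AddCircle.isCoveringMap_coe (1 : ℝ)).existsUnique_continuousMap_lifts
    (⟨fun w => (u w).1, by fun_prop⟩ : C(Disk, UnitAddCircle)) (vertex 0) w₀.re
    (by rw [ContinuousMap.coe_mk, ← h]; rfl)
  obtain ⟨F₂, ⟨h3, h4⟩, -⟩ := (AddCircle.isCoveringMap_coe (1 : ℝ)).existsUnique_continuousMap_lifts
    (⟨fun w => (u w).2, by fun_prop⟩ : C(Disk, UnitAddCircle)) (vertex 0) w₀.im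
    (by rw [ContinuousMap.coe_mk, ← h]; rfl)
  refine ⟨⟨fun w => ⟨F₁ w, F₂ w⟩, ?_⟩, ?_, fun w => ?_⟩
  · have : (fun w => (⟨F₁ w, F₂ w⟩ : ℂ)) = fun w => (F₁ w : ℂ) + F₂ w * Complex.I := by
      funext w
      exact Complex.mk_eq_add_mul_I _ _
    rw [this]
    fun_prop
  · exact Complex.ext h1 h3
  · exact Prod.ext (congrFun h2 w) (congrFun h4 w)

theorem continuous_cover : Continuous cover := by
  unfold cover
  exact ((AddCircle.continuous_mk' 1).comp Complex.continuous_re).prodMk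
    ((AddCircle.continuous_mk' 1).comp Complex.continuous_im)

theorem lift_unique {F F' : C(Disk, ℂ)} (h : ∀ w, cover (F w) = cover (F' w))
    (h0 : F (vertex 0) = F' (vertex 0)) : F = F' := by
  have h1 : (fun w => (F w).re) = fun w => (F' w).re :=
    (AddCircle.isCoveringMap_coe (1 : ℝ)).eq_of_comp_eq (by fun_prop) (by fun_prop)
      (funext fun w => congrArg Prod.fst (h w)) (vertex 0) (by rw [h0])
  have h2 : (fun w => (F w).im) = fun w => (F' w).im :=
    (AddCircle.isCoveringMap_coe (1 : ℝ)).eq_of_comp_eq (by fun_prop) (by fun_prop)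
      (funext fun w => congrArg Prod.snd (h w)) (vertex 0) (by rw [h0])
  exact ContinuousMap.ext fun w => Complex.ext (congrFun h1 w) (congrFun h2 w)

/-- Extension by zero to `ℂ` of a function on the closed disk. -/
def diskExt (F : C(Disk, ℂ)) : ℂ → ℂ := Function.extend Subtype.val F 0

theorem diskExt_coe (F : C(Disk, ℂ)) (w : Disk) : diskExt F w = F w :=
  Subtype.val_injective.extend_apply _ _ _

theorem continuousOn_diskExt (F : C(Disk, ℂ)) :
    ContinuousOn (diskExt F) (Metric.closedBall 0 1) := by
  rw [continuousOn_iff_continuous_domRestrict]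
  exact F.continuous.congr fun w => (diskExt_coe F w).symm

/-- A lift of a holomorphic triangle is holomorphic: it differs from any local holomorphic lift by a
continuous function with values in the lattice. -/
theorem differentiableOn_diskExt {L₀ L₁ L₂ : Set Torus} {y x₁ x₂ : Torus}
    (T : HolTriangle L₀ L₁ L₂ y x₁ x₂) {F : C(Disk, ℂ)} (hF : ∀ w, cover (F w) = T.u w) :
    DifferentiableOn ℂ (diskExt F) (Metric.ball 0 1) := by
  intro z hz
  set w : Disk := ⟨z, Metric.ball_subset_closedBall hz⟩ with hw
  obtain ⟨f, hf, hfu⟩ := T.holomorphic w (by simpa using hz)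
  have hcont : ContinuousAt (fun v : Disk => F v - f v - (F w - f w)) w :=
    (F.continuous.continuousAt.sub
      (hf.continuousAt.comp (f := (Subtype.val : Disk → ℂ)) continuous_subtype_val.continuousAt)).sub
      continuousAt_const
  have hsmall : ∀ᶠ v in 𝓝 w, ‖F v - f v - (F w - f w)‖ < 1 := by
    refine hcont.norm.eventually_lt (continuousAt_const (y := (1 : ℝ))) ?_
    simp
  have hfw := hfu.self_of_nhds
  have heq : ∀ᶠ v : Disk in 𝓝 w, F v = f v + (F w - f w) := by
    filter_upwards [hfu, hsmall] with v hv hs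
    have h1 : cover (F v - f v - (F w - f w)) = cover 0 := by
      obtain ⟨⟨a, ha⟩, b, hb⟩ := cover_eq_cover_iff.mp ((hF v).trans hv)
      obtain ⟨⟨a', ha'⟩, b', hb'⟩ := cover_eq_cover_iff.mp ((hF w).trans hfw)
      refine cover_eq_cover_iff.mpr ⟨⟨a - a', ?_⟩, b - b', ?_⟩
      · simp [ha, ha']
      · simp [hb, hb']
    have := eq_zero_of_mem_lattice_of_norm_lt_one h1 hs
    linear_combination this
  have hnhds : Metric.closedBall (0 : ℂ) 1 ∈ 𝓝 z :=
    mem_of_superset (Metric.isOpen_ball.mem_nhds hz) Metric.ball_subset_closedBall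
  have heq' : diskExt F =ᶠ[𝓝 z] fun v => f v + (F w - f w) := by
    have hmap : map (Subtype.val : Disk → ℂ) (𝓝 w) = 𝓝 z := map_nhds_subtype_coe_eq_nhds _ hnhds
    rw [← hmap]
    refine eventually_map.mpr ?_
    filter_upwards [heq] with v hv
    rw [diskExt_coe, hv]
  exact ((hf.differentiableAt.add_const _).congr_of_eventuallyEq heq').differentiableWithinAt

theorem eq_of_forall_int {f : unitInterval → ℝ} (hf : Continuous f) (h : ∀ t, ∃ n : ℤ, f t = n)
    (s t : unitInterval) : f s = f t := by
  choose n hn using h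
  have hc : Continuous n := by
    rw [Int.isClosedEmbedding_coe_real.isEmbedding.continuous_iff]
    exact hf.congr hn
  rw [hn, hn, PreconnectedSpace.constant inferInstance hc (x := s) (y := t)]

/-- A lift maps a boundary arc that goes into `L_(m)` into a single line of slope `-m`. -/
theorem lift_side_mem_line {u : C(Disk, Torus)} {F : C(Disk, ℂ)} (hF : ∀ w, cover (F w) = u w)
    {j : Fin 3} {m : ℤ} (h : ∀ t, u (side j t) ∈ lag m) (s t : unitInterval) :
    (F (side j s)).im + m * (F (side j s)).re = (F (side j t)).im + m * (F (side j t)).re := by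
  refine eq_of_forall_int (f := fun t => (F (side j t)).im + m * (F (side j t)).re)
    (by fun_prop) (fun t => ?_) s t
  have := h t
  rw [← hF] at this
  exact cover_mem_lag_iff.mp this

theorem bdryPt_add_one (s : ℝ) : bdryPt (s + 1) = bdryPt s := by
  apply Subtype.ext
  rw [coe_bdryPt, coe_bdryPt, Complex.exp_eq_exp_iff_exists_int]
  exact ⟨1, by push_cast; ring⟩

theorem side_apply (j : Fin 3) (t : unitInterval) : side j t = bdryPt (((j : ℝ) + t) / 3) := rfl

theorem vertex_apply (j : Fin 3) : vertex j = bdryPt ((j : ℝ) / 3) := rfl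

theorem side_zero_zero : side 0 0 = vertex 0 := by simp [side_apply, vertex_apply]

theorem side_zero_one : side 0 1 = vertex 1 := by simp [side_apply, vertex_apply]

theorem side_one_zero : side 1 0 = vertex 1 := by simp [side_apply, vertex_apply]

theorem side_one_one : side 1 1 = vertex 2 := by
  rw [side_apply, vertex_apply]
  norm_num

theorem side_two_zero : side 2 0 = vertex 2 := by simp [side_apply, vertex_apply]

theorem side_two_one : side 2 1 = vertex 0 := by
  have h := bdryPt_add_one 0
  rw [side_apply, vertex_apply]
  convert h using 2 <;> norm_num

theorem exists_bdryPt {w : Disk} (hw : ‖(w : ℂ)‖ = 1) : ∃ s ∈ Set.Ico (0 : ℝ) 1, w = bdryPt s := by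
  obtain ⟨x, hx⟩ : ∃ x : ℝ, (w : ℂ).arg = 2 * Real.pi * x :=
    ⟨(w : ℂ).arg / (2 * Real.pi), by field_simp⟩
  refine ⟨Int.fract x, ⟨Int.fract_nonneg _, Int.fract_lt_one _⟩, ?_⟩
  apply Subtype.ext
  rw [coe_bdryPt]
  have h1 := Complex.norm_mul_exp_arg_mul_I (w : ℂ)
  rw [hw, Complex.ofReal_one, one_mul, hx] at h1
  rw [← h1, Complex.exp_eq_exp_iff_exists_int]
  refine ⟨⌊x⌋, ?_⟩
  have h2 : (x : ℂ) = Int.fract x + ⌊x⌋ := by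
    exact_mod_cast (Int.fract_add_floor x).symm
  push_cast
  linear_combination (2 * Real.pi * Complex.I : ℂ) * h2

theorem bdryPt_eq_side (j : Fin 3) {s : ℝ} (h0 : (j : ℝ) / 3 ≤ s) (h1 : s ≤ ((j : ℝ) + 1) / 3) :
    ∃ t, bdryPt s = side j t := by
  refine ⟨⟨3 * s - j, by linarith, by linarith⟩, ?_⟩
  rw [side_apply]
  congr 1
  dsimp only
  ring

theorem exists_side {w : Disk} (hw : ‖(w : ℂ)‖ = 1) : ∃ j t, w = side j t := by
  obtain ⟨s, hs, rfl⟩ := exists_bdryPt hw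
  by_cases h1 : s ≤ 1 / 3
  · exact ⟨0, bdryPt_eq_side 0 (by simpa using hs.1) (by simpa using h1)⟩
  by_cases h2 : s ≤ 2 / 3
  · exact ⟨1, bdryPt_eq_side 1 (by simp; linarith) (by simp; linarith)⟩
  · exact ⟨2, bdryPt_eq_side 2 (by simp; linarith) (by simp; linarith [hs.2])⟩

/-! ### Classification of the holomorphic triangles -/

/-- The model triangle, translated by a real number and rescaled by a real factor (which may be
negative or zero), so that the first two marked points go to `X₀` and `X₁` on the real axis. -/
def modelLift (p q X₀ X₁ : ℝ) (z : ℂ) : ℂ :=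
  X₀ + (((X₁ - X₀) / ((modelMap p q (bdryPt (1 / 3))).re - (modelMap p q (bdryPt 0)).re) : ℝ) : ℂ) *
    (modelMap p q z - modelMap p q (bdryPt 0))

section Model

variable {p q : ℝ}

theorem continuousOn_modelLift (hp : 0 < p) (hpq : p < q) (X₀ X₁ : ℝ) :
    ContinuousOn (modelLift p q X₀ X₁) (Metric.closedBall 0 1) :=
  continuousOn_const.add (continuousOn_const.mul ((continuousOn_modelMap hp hpq).sub continuousOn_const))

theorem analyticAt_modelLift (X₀ X₁ : ℝ) {z : ℂ} (hz : z ∈ slitDomain) :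
    AnalyticAt ℂ (modelLift p q X₀ X₁) z :=
  analyticAt_const.add (analyticAt_const.mul ((analyticAt_modelMap p q hz).sub analyticAt_const))

theorem modelLift_bdryPt_zero (X₀ X₁ : ℝ) : modelLift p q X₀ X₁ (bdryPt 0) = X₀ := by
  simp [modelLift]

theorem modelLift_re (X₀ X₁ : ℝ) (z : ℂ) : (modelLift p q X₀ X₁ z).re =
    X₀ + (X₁ - X₀) / ((modelMap p q (bdryPt (1 / 3))).re - (modelMap p q (bdryPt 0)).re) *
      ((modelMap p q z).re - (modelMap p q (bdryPt 0)).re) := by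
  rw [modelLift, Complex.add_re, Complex.re_ofReal_mul, Complex.ofReal_re, Complex.sub_re]

theorem modelLift_im (X₀ X₁ : ℝ) (z : ℂ) : (modelLift p q X₀ X₁ z).im =
    (X₁ - X₀) / ((modelMap p q (bdryPt (1 / 3))).re - (modelMap p q (bdryPt 0)).re) *
      ((modelMap p q z).im - (modelMap p q (bdryPt 0)).im) := by
  rw [modelLift, Complex.add_im, Complex.im_ofReal_mul, Complex.ofReal_im, Complex.sub_im, zero_add]

variable (hp : 0 < p) (hpq : p < q)

include hp hpq

theorem modelLift_im_zero (X₀ X₁ : ℝ) {s : ℝ} (hs : s ∈ Set.Icc (0 : ℝ) (1 / 3)) :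
    (modelLift p q X₀ X₁ (bdryPt s)).im = 0 := by
  rw [modelLift_im, im_modelMap_zero hp hpq hs, sub_self, mul_zero]

theorem modelLift_bdryPt_third (X₀ X₁ : ℝ) : modelLift p q X₀ X₁ (bdryPt (1 / 3)) = X₁ := by
  refine Complex.ext ?_ (modelLift_im_zero hp hpq X₀ X₁ ⟨by norm_num, le_rfl⟩)
  have h := strictMonoOn_re_modelMap_zero hp hpq (a := 0) (b := 1 / 3) ⟨le_rfl, by norm_num⟩
    ⟨by norm_num, le_rfl⟩ (by norm_num)
  rw [modelLift_re, div_mul_cancel₀ _ (sub_pos.mpr h).ne', Complex.ofReal_re]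
  ring

theorem modelLift_line_one (X₀ X₁ : ℝ) {s : ℝ} (hs : s ∈ Set.Icc (1 / 3 : ℝ) (2 / 3)) :
    (modelLift p q X₀ X₁ (bdryPt s)).im + p * (modelLift p q X₀ X₁ (bdryPt s)).re = p * X₁ := by
  have h1 := im_add_re_modelMap_one hp hpq hs
  have h2 := modelLift_bdryPt_third hp hpq X₀ X₁
  have h3 := congrArg Complex.re h2
  have h4 := congrArg Complex.im h2
  rw [modelLift_re, Complex.ofReal_re] at h3
  rw [modelLift_im, Complex.ofReal_im] at h4
  rw [modelLift_re, modelLift_im]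
  linear_combination ((X₁ - X₀) / ((modelMap p q (bdryPt (1 / 3))).re - (modelMap p q (bdryPt 0)).re))
    * h1 + p * h3 + h4

theorem modelLift_line_two (X₀ X₁ : ℝ) {s : ℝ} (hs : s ∈ Set.Icc (2 / 3 : ℝ) 1) :
    (modelLift p q X₀ X₁ (bdryPt s)).im + q * (modelLift p q X₀ X₁ (bdryPt s)).re = q * X₀ := by
  have h1 := im_add_re_modelMap_two hp hpq hs
  have h2 := im_add_re_modelMap_two hp hpq (s := 1) ⟨by norm_num, le_rfl⟩
  have h3 := bdryPt_add_one 0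
  rw [zero_add] at h3
  rw [h3] at h2
  rw [modelLift_re, modelLift_im]
  linear_combination ((X₁ - X₀) / ((modelMap p q (bdryPt (1 / 3))).re - (modelMap p q (bdryPt 0)).re))
    * (h1 - h2)

theorem modelLift_vertex_two {X₀ X₁ X₂ : ℝ} (h : p * X₁ + (q - p) * X₂ = q * X₀) :
    modelLift p q X₀ X₁ (bdryPt (2 / 3)) = ⟨X₂, -(p * X₂) + p * X₁⟩ := by
  have h1 := modelLift_line_one hp hpq X₀ X₁ (s := 2 / 3) ⟨by norm_num, le_rfl⟩
  have h2 := modelLift_line_two hp hpq X₀ X₁ (s := 2 / 3) ⟨le_rfl, by norm_num⟩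
  have h3 : (modelLift p q X₀ X₁ (bdryPt (2 / 3))).re = X₂ := by
    have : (q - p) ≠ 0 := (sub_pos.mpr hpq).ne'
    apply mul_left_cancel₀ this
    linarith
  refine Complex.ext h3 ?_
  dsimp only
  rw [h3] at h1
  linarith

end Model

/-- The line `im + k_j re = const` that contains the `j`-th side of the model triangle. -/
theorem modelLift_side {p q : ℤ} (hp : 0 < p) (hpq : p < q) (X₀ X₁ : ℝ) (j : Fin 3)
    (t : unitInterval) :
    (modelLift p q X₀ X₁ (side j t)).im + ((![0, p, q] j : ℤ) : ℝ) * (modelLift p q X₀ X₁ (side j t)).re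
      = (![0, p * X₁, q * X₀] : Fin 3 → ℝ) j := by
  have hp' : (0 : ℝ) < p := by exact_mod_cast hp
  have hpq' : (p : ℝ) < q := by exact_mod_cast hpq
  have ht0 := t.2.1
  have ht1 := t.2.2
  rw [side_apply]
  fin_cases j
  · simpa using modelLift_im_zero hp' hpq' X₀ X₁ (s := (0 + t) / 3)
      ⟨by linarith, by linarith⟩
  · simpa using modelLift_line_one hp' hpq' X₀ X₁ (s := (1 + t) / 3)
      ⟨by linarith, by linarith⟩
  · simpa using modelLift_line_two hp' hpq' X₀ X₁ (s := (2 + t) / 3)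
      ⟨by linarith, by linarith⟩

section Classification

variable {p q : ℤ} (hp : 0 < p) (hpq : p < q) {y x₁ x₂ : Torus}

include hp hpq

/-- A lift of a holomorphic triangle is the model triangle with the same first two vertices. -/
theorem lift_eq_modelLift (T : HolTriangle (lag 0) (lag p) (lag q) y x₁ x₂) {F : C(Disk, ℂ)}
    (hF : ∀ w, cover (F w) = T.u w) {X₀ : ℝ} (h0 : F (vertex 0) = X₀) (w : Disk) :
    F w = modelLift p q X₀ (F (vertex 1)).re w := by
  have hp' : (0 : ℝ) < p := by exact_mod_cast hp
  have hpq' : (p : ℝ) < q := by exact_mod_cast hpq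
  have e0 : ∀ t, (F (side 0 t)).im + ((0 : ℤ) : ℝ) * (F (side 0 t)).re = 0 := by
    intro t
    rw [lift_side_mem_line hF (m := 0) T.side_zero t 0, side_zero_zero, h0]
    simp
  have e1 : ∀ t, (F (side 1 t)).im + p * (F (side 1 t)).re = p * (F (vertex 1)).re := by
    intro t
    have := e0 1
    rw [side_zero_one] at this
    simp only [Int.cast_zero, zero_mul, add_zero] at this
    rw [lift_side_mem_line hF T.side_one t 0, side_one_zero, this, zero_add]
  have e2 : ∀ t, (F (side 2 t)).im + q * (F (side 2 t)).re = q * X₀ := by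
    intro t
    rw [lift_side_mem_line hF T.side_two t 1, side_two_one, h0]
    simp
  set X₁ := (F (vertex 1)).re with hX₁
  obtain ⟨a, ha⟩ := eq_const_of_boundary_subset_lines (fun j : Fin 3 => ((![0, p, q] j : ℤ) : ℝ))
    (f := fun z => diskExt F z - modelLift p q X₀ X₁ z)
    ((continuousOn_diskExt F).sub (continuousOn_modelLift hp' hpq' X₀ X₁))
    ((differentiableOn_diskExt T hF).sub fun z hz =>
      (analyticAt_modelLift X₀ X₁ (mem_slitDomain_of_norm_lt
        (mem_ball_zero_iff.mp hz))).differentiableAt.differentiableWithinAt)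
    (fun z hz => by
      obtain ⟨j, t, hjt⟩ := exists_side (w := ⟨z, mem_closedBall_zero_iff.mpr hz.le⟩) hz
      refine ⟨j, ?_⟩
      have hz' : z = (side j t : ℂ) := congrArg Subtype.val hjt
      have h1 := modelLift_side hp hpq X₀ X₁ j t
      have h2 : (F (side j t)).im + ((![0, p, q] j : ℤ) : ℝ) * (F (side j t)).re =
          (![0, p * X₁, q * X₀] : Fin 3 → ℝ) j := by
        fin_cases j
        · simpa using e0 t
        · simpa using e1 t
        · simpa using e2 t
      rw [hz', diskExt_coe, Complex.sub_im, Complex.sub_re]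
      linarith)
  have hv := ha (vertex 0) (vertex 0).2
  have hw := ha w w.2
  have hv0 : (vertex 0 : ℂ) = bdryPt 0 := by simp [vertex_apply]
  rw [diskExt_coe, h0, hv0, modelLift_bdryPt_zero, sub_self] at hv
  rw [diskExt_coe, ← hv, sub_eq_zero] at hw
  exact hw

/-- The model triangle is a holomorphic triangle as soon as its vertices lie over the given points. -/
theorem exists_holTriangle {X₀ X₁ X₂ : ℝ} (hy : cover X₀ = y) (hx₁ : cover X₁ = x₁)
    (hx₂ : cover ⟨X₂, -(p * X₂) + p * X₁⟩ = x₂) (hrel : p * X₁ + (q - p) * X₂ = q * X₀)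
    (hyq : y ∈ lag q) (hx₁p : x₁ ∈ lag p) :
    ∃ T : HolTriangle (lag 0) (lag p) (lag q) y x₁ x₂,
      ∀ w, T.u w = cover (modelLift p q X₀ X₁ w) := by
  have hp' : (0 : ℝ) < p := by exact_mod_cast hp
  have hpq' : (p : ℝ) < q := by exact_mod_cast hpq
  obtain ⟨a, ha⟩ := cover_mem_lag_iff.mp (hx₁ ▸ hx₁p)
  obtain ⟨b, hb⟩ := cover_mem_lag_iff.mp (hy ▸ hyq)
  simp only [Complex.ofReal_im, Complex.ofReal_re, zero_add] at ha hb
  have hside : ∀ j t, cover (modelLift p q X₀ X₁ (side j t)) ∈ lag (![0, p, q] j) := by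
    intro j t
    rw [cover_mem_lag_iff, modelLift_side hp hpq]
    fin_cases j
    · exact ⟨0, by simp⟩
    · exact ⟨a, by simpa using ha⟩
    · exact ⟨b, by simpa using hb⟩
  refine ⟨{
    u := ⟨fun w => cover (modelLift p q X₀ X₁ w), continuous_cover.comp
      ((continuousOn_modelLift hp' hpq' X₀ X₁).comp_continuous continuous_subtype_val fun w => w.2)⟩
    vertex_zero := ?_
    vertex_one := ?_
    vertex_two := ?_
    side_zero := hside 0
    side_one := hside 1
    side_two := hside 2
    smooth := fun w hw => ⟨modelLift p q X₀ X₁, ?_, Eventually.of_forall fun v => rfl⟩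
    holomorphic := fun w hw => ⟨modelLift p q X₀ X₁,
      analyticAt_modelLift X₀ X₁ (mem_slitDomain_of_norm_lt hw), Eventually.of_forall fun v => rfl⟩ },
    fun w => rfl⟩
  · change cover (modelLift p q X₀ X₁ (vertex 0)) = y
    rw [vertex_apply, show (((0 : Fin 3) : ℕ) : ℝ) / 3 = 0 by simp, modelLift_bdryPt_zero, hy]
  · change cover (modelLift p q X₀ X₁ (vertex 1)) = x₁
    rw [vertex_apply, show (((1 : Fin 3) : ℕ) : ℝ) / 3 = 1 / 3 by simp,
      modelLift_bdryPt_third hp' hpq', hx₁]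
  · change cover (modelLift p q X₀ X₁ (vertex 2)) = x₂
    rw [vertex_apply, show (((2 : Fin 3) : ℕ) : ℝ) / 3 = 2 / 3 by simp,
      modelLift_vertex_two hp' hpq' hrel, hx₂]
  · have h := analyticAt_modelLift (p := p) (q := q) X₀ X₁ (mem_slitDomain
      (mem_closedBall_zero_iff.mp w.2) fun j h => hw j (Subtype.ext h))
    exact (h.contDiffAt (n := ∞)).restrict_scalars ℝ |>.contDiffWithinAt

end Classification

theorem HolTriangle.ext_u {L₀ L₁ L₂ : Set Torus} {y x₁ x₂ : Torus}
    {T T' : HolTriangle L₀ L₁ L₂ y x₁ x₂} (h : T.u = T'.u) : T = T' := by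
  cases T
  cases T'
  congr

/-! ### The sign of a triangle -/

/-- If a map restricts to injections with the same image on two disjoint sets, then their union has
even cardinality. -/
theorem even_ncard_union {α β : Type*} {A B : Set α} (hd : Disjoint A B) {f : α → β}
    (hA : Set.InjOn f A) (hB : Set.InjOn f B) (h : f '' A = f '' B) : Even (A ∪ B).ncard := by
  have hc : A.ncard = B.ncard := by
    rw [← hA.ncard_image, h, hB.ncard_image]
  by_cases hf : A.Finite
  · have hfB : B.Finite := Set.Finite.of_finite_image (h ▸ hf.image f) hB
    rw [Set.ncard_union_eq hd hf hfB, hc]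
    exact ⟨_, rfl⟩
  · -- By convention an infinite set has `ncard` zero.
    rw [Set.Infinite.ncard (Set.Infinite.mono Set.subset_union_left hf)]
    exact Even.zero

theorem bdryPt_eq_iff {s s' : ℝ} : bdryPt s = bdryPt s' ↔ ∃ n : ℤ, s = s' + n := by
  rw [Subtype.ext_iff, coe_bdryPt, coe_bdryPt, Complex.exp_eq_exp_iff_exists_int]
  refine exists_congr fun n => ?_
  have h2 : (2 * Real.pi * Complex.I : ℂ) ≠ 0 := Complex.two_pi_I_ne_zero
  rw [← Complex.ofReal_inj]
  push_cast
  constructor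
  · intro h
    apply mul_left_cancel₀ h2
    linear_combination h
  · intro h
    linear_combination (2 * Real.pi * Complex.I : ℂ) * h

section Sign

variable {p q : ℝ} (hp : 0 < p) (hpq : p < q)

include hp hpq

theorem strictMonoOn_re_modelMap_two_zero :
    StrictMonoOn (fun s : ℝ => (modelMap p q (bdryPt s)).re) (Set.Icc (2 / 3) (4 / 3)) := by
  have h := strictMonoOn_re_modelMap_zero hp hpq
  have h1 : StrictMonoOn (fun s : ℝ => (modelMap p q (bdryPt s)).re) (Set.Icc 1 (4 / 3)) := by
    intro s hs t ht hst
    have := h (a := s - 1) (b := t - 1) ⟨by linarith [hs.1], by linarith [hs.2]⟩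
      ⟨by linarith [ht.1], by linarith [ht.2]⟩ (by linarith)
    dsimp only at this
    rw [← bdryPt_add_one (s - 1), ← bdryPt_add_one (t - 1), sub_add_cancel, sub_add_cancel] at this
    exact this
  rw [← Set.Icc_union_Icc_eq_Icc (a := (2 / 3 : ℝ)) (b := 1) (c := 4 / 3) (by norm_num) (by norm_num)]
  exact (strictMonoOn_re_modelMap_two hp hpq).union h1 (isGreatest_Icc (by norm_num))
    (isLeast_Icc (by norm_num))

/-- The real part of the boundary values of the model triangle decreases along the second arc and
increases along the other two, so every value that is not taken at the two turning points is taken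
equally often on either part. -/
theorem even_ncard_re_modelMap {N : Set ℝ} (h1 : (modelMap p q (bdryPt (1 / 3))).re ∉ N)
    (h2 : (modelMap p q (bdryPt (2 / 3))).re ∉ N) :
    Even (Set.ncard {w : Disk | ‖(w : ℂ)‖ = 1 ∧ (modelMap p q w).re ∈ N}) := by
  set H : ℝ → ℝ := fun s => (modelMap p q (bdryPt s)).re with hH
  have hHc : Continuous H := Complex.continuous_re.comp (continuous_modelMap_bdryPt hp hpq)
  have hper : H (4 / 3) = H (1 / 3) := by
    rw [hH]
    dsimp only
    rw [← bdryPt_add_one (1 / 3)]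
    norm_num
  have hanti : StrictAntiOn H (Set.Icc (1 / 3) (2 / 3)) := strictAntiOn_re_modelMap_one hp hpq
  have hmono : StrictMonoOn H (Set.Icc (2 / 3) (4 / 3)) := strictMonoOn_re_modelMap_two_zero hp hpq
  set A : Set Disk := bdryPt '' {s | s ∈ Set.Icc (1 / 3) (2 / 3) ∧ H s ∈ N} with hA
  set B : Set Disk := bdryPt '' {s | s ∈ Set.Icc (2 / 3) (4 / 3) ∧ H s ∈ N} with hB
  have hS : {w : Disk | ‖(w : ℂ)‖ = 1 ∧ (modelMap p q w).re ∈ N} = A ∪ B := by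
    ext w
    constructor
    · rintro ⟨hw, hwN⟩
      obtain ⟨s, hs, rfl⟩ := exists_bdryPt hw
      by_cases k1 : s ≤ 1 / 3
      · right
        refine ⟨s + 1, ⟨⟨by linarith [hs.1], by linarith⟩, ?_⟩, bdryPt_add_one s⟩
        rw [hH]
        dsimp only
        rw [bdryPt_add_one]
        exact hwN
      by_cases k2 : s ≤ 2 / 3
      · left
        exact ⟨s, ⟨⟨by linarith, k2⟩, hwN⟩, rfl⟩
      · right
        exact ⟨s, ⟨⟨by linarith, by linarith [hs.2]⟩, hwN⟩, rfl⟩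
    · rintro (⟨s, ⟨_, hs⟩, rfl⟩ | ⟨s, ⟨_, hs⟩, rfl⟩) <;> exact ⟨norm_bdryPt s, hs⟩
  rw [hS]
  refine even_ncard_union (f := fun w : Disk => (modelMap p q w).re) ?_ ?_ ?_ ?_
  · rw [Set.disjoint_left]
    rintro _ ⟨s, ⟨hs, hsN⟩, rfl⟩ ⟨t, ⟨ht, htN⟩, hts⟩
    obtain ⟨n, hn⟩ := bdryPt_eq_iff.mp hts
    have hn0 : (-1 : ℝ) < n := by linarith [ht.1, hs.2]
    have hn1 : (n : ℝ) ≤ 1 := by linarith [ht.2, hs.1]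
    have hn0' : -1 < n := by exact_mod_cast hn0
    have hn1' : n ≤ 1 := by exact_mod_cast hn1
    obtain rfl | rfl : n = 0 ∨ n = 1 := by omega
    · rw [Int.cast_zero, add_zero] at hn
      rw [show s = 2 / 3 by linarith [hs.2, ht.1]] at hsN
      exact h2 hsN
    · rw [Int.cast_one] at hn
      rw [show s = 1 / 3 by linarith [hs.1, ht.2]] at hsN
      exact h1 hsN
  · rintro _ ⟨s, ⟨hs, -⟩, rfl⟩ _ ⟨t, ⟨ht, -⟩, rfl⟩ h
    rw [hanti.injOn hs ht h]
  · rintro _ ⟨s, ⟨hs, -⟩, rfl⟩ _ ⟨t, ⟨ht, -⟩, rfl⟩ h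
    rw [hmono.injOn hs ht h]
  · have hAim : H '' Set.Icc (1 / 3) (2 / 3) = Set.Icc (H (2 / 3)) (H (1 / 3)) := by
      refine Set.Subset.antisymm ?_ (intermediate_value_Icc' (by norm_num) hHc.continuousOn)
      rintro _ ⟨s, hs, rfl⟩
      exact ⟨hanti.antitoneOn hs ⟨by norm_num, le_rfl⟩ hs.2,
        hanti.antitoneOn ⟨le_rfl, by norm_num⟩ hs hs.1⟩
    have hBim : H '' Set.Icc (2 / 3) (4 / 3) = Set.Icc (H (2 / 3)) (H (1 / 3)) := by
      rw [← hper]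
      refine Set.Subset.antisymm ?_ (intermediate_value_Icc (by norm_num) hHc.continuousOn)
      rintro _ ⟨s, hs, rfl⟩
      exact ⟨hmono.monotoneOn ⟨le_rfl, by norm_num⟩ hs hs.1,
        hmono.monotoneOn hs ⟨by norm_num, le_rfl⟩ hs.2⟩
    have key : ∀ I : Set ℝ, (fun w : Disk => (modelMap p q w).re) ''
        (bdryPt '' {s | s ∈ I ∧ H s ∈ N}) = H '' I ∩ N := by
      intro I
      rw [Set.image_image]
      ext v
      constructor
      · rintro ⟨s, ⟨hs, hsN⟩, rfl⟩
        exact ⟨⟨s, hs, rfl⟩, hsN⟩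
      · rintro ⟨⟨s, hs, rfl⟩, hsN⟩
        exact ⟨s, ⟨hs, hsN⟩, rfl⟩
    rw [hA, hB, key, key, hAim, hBim]

end Sign

section SignOne

variable {p q : ℤ} (hp : 0 < p) (hpq : p < q) {y x₁ x₂ : Torus}

theorem re_ne_of_irrational {ε : ℝ} (hε : Irrational ε) {d l : ℤ} (n : ℤ) :
    (l : ℝ) / d ≠ ε + n := by
  intro h
  refine hε ⟨(l : ℚ) / d - n, ?_⟩
  push_cast
  linarith

include hp hpq

/-- Every holomorphic triangle is counted with sign `+1`. -/
theorem sign_eq_one {ε : ℝ} (hε : Irrational ε) (T : HolTriangle (lag 0) (lag p) (lag q) y x₁ x₂)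
    {F : C(Disk, ℂ)} (hF : ∀ w, cover (F w) = T.u w) {X₀ : ℝ} (h0 : F (vertex 0) = X₀) {l l' : ℤ}
    (h1 : (F (vertex 1)).re = (l : ℝ) / p) (h2 : (F (vertex 2)).re = (l' : ℝ) / (q - p : ℤ)) :
    T.sign ε 0 p q = 1 := by
  have hp' : (0 : ℝ) < p := by exact_mod_cast hp
  have hpq' : (p : ℝ) < q := by exact_mod_cast hpq
  have hlift := lift_eq_modelLift hp hpq T hF h0
  set X₁ := (F (vertex 1)).re with hX₁
  set c := (X₁ - X₀) / ((modelMap p q (bdryPt (1 / 3))).re - (modelMap p q (bdryPt 0)).re) with hc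
  set N : Set ℝ := {v | ∃ n : ℤ, X₀ + c * (v - (modelMap p q (bdryPt 0)).re) = ε + n} with hN
  have hset : {w : Disk | ‖(w : ℂ)‖ = 1 ∧
      (T.u w = star ε 0 ∨ T.u w = star ε p ∨ T.u w = star ε q)} =
      {w : Disk | ‖(w : ℂ)‖ = 1 ∧ (modelMap p q w).re ∈ N} := by
    ext w
    -- A point of `L_(m)` is the base point `⋆_(m)` if and only if its first coordinate is `ε`.
    refine and_congr_right fun hw => ?_
    have hmem : (modelMap p q w).re ∈ N ↔ ∃ n : ℤ, (F w).re = ε + n := by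
      rw [hlift w, modelLift_re]
      rfl
    rw [hmem]
    constructor
    · have key : ∀ m : ℤ, T.u w = star ε m → ∃ n : ℤ, (F w).re = ε + n := by
        intro m hm
        rw [← hF, star, cover_eq_cover_iff] at hm
        exact hm.1
      rintro (h | h | h) <;> exact key _ h
    · rintro ⟨n, hn⟩
      have hfst : (ε : UnitAddCircle) = (T.u w).1 := by
        rw [← hF]
        exact coe_eq_coe_iff.mpr ⟨-n, by push_cast; linarith⟩
      obtain ⟨j, t, rfl⟩ := exists_side hw
      fin_cases j
      · exact Or.inl (exists_lift_mem_lag (T.side_zero t) hfst)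
      · exact Or.inr (Or.inl (exists_lift_mem_lag (T.side_one t) hfst))
      · exact Or.inr (Or.inr (exists_lift_mem_lag (T.side_two t) hfst))
  have heven := even_ncard_re_modelMap hp' hpq' (N := N)
    (by
      rintro ⟨n, hn⟩
      have h3 := modelLift_re (p := p) (q := q) X₀ X₁ (bdryPt (1 / 3))
      rw [modelLift_bdryPt_third hp' hpq', Complex.ofReal_re] at h3
      rw [← hc] at h3
      rw [← h3, h1] at hn
      exact re_ne_of_irrational hε n hn)
    (by
      rintro ⟨n, hn⟩
      have h3 := modelLift_re (p := p) (q := q) X₀ X₁ (bdryPt (2 / 3))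
      have h4 := hlift (vertex 2)
      rw [vertex_apply, show (((2 : Fin 3) : ℕ) : ℝ) / 3 = 2 / 3 by simp] at h4 h2
      rw [← hc, ← h4, h2] at h3
      rw [← h3] at hn
      exact re_ne_of_irrational hε n hn)
  rw [HolTriangle.sign, hset]
  exact heven.neg_one_pow

end SignOne

/-! ### Parallel transport along the sides -/

theorem liftFst_comp_side {u : C(Disk, Torus)} {F : C(Disk, ℂ)} (hF : ∀ w, cover (F w) = u w)
    (j : Fin 3) (t : unitInterval) :
    liftFst (u.comp (side j)) t = (F (side j t)).re - ⌊(F (side j 0)).re⌋ := by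
  have h := (AddCircle.isCoveringMap_coe (1 : ℝ)).eq_liftPath_iff'
    (γ := (⟨fun t => ((u.comp (side j)) t).1, by fun_prop⟩ : C(unitInterval, UnitAddCircle)))
    (e := (AddCircle.equivIco (1 : ℝ) 0 ((u.comp (side j)) 0).1 : ℝ))
    (γ_0 := (AddCircle.coe_equivIco (p := (1 : ℝ)) (a := 0) (y := ((u.comp (side j)) 0).1)).symm)
    (Γ := ⟨fun t => (F (side j t)).re - ⌊(F (side j 0)).re⌋, by fun_prop⟩)
  have h2 := h.mpr ⟨?_, ?_⟩
  · exact (congrArg (fun f : C(unitInterval, ℝ) => f t) h2).symm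
  · funext t
    change (((F (side j t)).re - ⌊(F (side j 0)).re⌋ : ℝ) : UnitAddCircle) = (u (side j t)).1
    rw [← hF]
    exact coe_eq_coe_iff.mpr ⟨-⌊(F (side j 0)).re⌋, by push_cast; ring⟩
  · change (F (side j 0)).re - ⌊(F (side j 0)).re⌋ =
      (AddCircle.equivIco (1 : ℝ) 0 (u (side j 0)).1 : ℝ)
    rw [← hF]
    have h3 := AddCircle.coe_equivIco_mk_apply (1 : ℝ) (F (side j 0)).re
    rw [div_one, mul_one] at h3
    exact h3.symm

theorem transport_side {C : Type*} [CommRing C] (σ : C ≃+* C) {u : C(Disk, Torus)} {F : C(Disk, ℂ)}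
    (hF : ∀ w, cover (F w) = u w) (j : Fin 3) :
    transport σ (u.comp (side j)) =
      (σ : RingAut C) ^ (⌊(F (side j 0)).re⌋ - ⌊(F (side j 1)).re⌋) := by
  rw [transport, liftFst_comp_side hF, Int.floor_sub_intCast, neg_sub]

/-- The composite of the transports along the three sides telescopes. -/
theorem triangleTerm_eq {C : Type*} [CommRing C] (σ : C ≃+* C) {p q : ℤ} {ε : ℝ} {y x₁ x₂ : Torus}
    (T : HolTriangle (lag 0) (lag p) (lag q) y x₁ x₂) (hs : T.sign ε 0 p q = 1) {F : C(Disk, ℂ)}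
    (hF : ∀ w, cover (F w) = T.u w) (h0 : ⌊(F (vertex 0)).re⌋ = 0) (b a : C) :
    triangleTerm σ ε 0 p q b a T =
      ((σ : RingAut C) ^ ⌊(F (vertex 1)).re⌋) a * ((σ : RingAut C) ^ ⌊(F (vertex 2)).re⌋) b := by
  rw [triangleTerm, hs, one_smul, transport_side σ hF, transport_side σ hF, transport_side σ hF,
    side_zero_zero, side_zero_one, side_one_zero, side_one_one, side_two_zero, side_two_one, h0,
    map_one, mul_one, map_mul, ← RingAut.mul_apply, ← zpow_add, sub_zero, mul_comm]
  congr 3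
  ring

/-! ### The triangle product in terms of theta series -/

/-- The points of `L_(a) ∩ L_(a + d)` have first coordinates `k / d`. -/
theorem exists_fst_eq {a b d : ℤ} (hd : 0 < d) (hb : b = a + d) {x : Torus} (ha : x ∈ lag a)
    (hb' : x ∈ lag b) : ∃ k : ℤ, 0 ≤ k ∧ k < d ∧ (((k : ℝ) / d : ℝ) : UnitAddCircle) = x.1 := by
  have hd' : (0 : ℝ) < d := by exact_mod_cast hd
  obtain ⟨s, ⟨hs0, hs1⟩, hs⟩ := AddCircle.eq_coe_Ico x.1
  rw [exists_lift_mem_lag ha hs, cover_mem_lag_iff] at hb'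
  obtain ⟨k, hk⟩ := hb'
  have hk' : s * d = k := by
    rw [hb] at hk
    push_cast at hk
    linarith
  refine ⟨k, ?_, ?_, ?_⟩
  · have : (0 : ℝ) ≤ k := by rw [← hk']; positivity
    exact_mod_cast this
  · have : (k : ℝ) < d := by rw [← hk']; nlinarith
    exact_mod_cast this
  · rw [← hk', mul_div_cancel_right₀ _ hd'.ne', hs]

theorem floor_div_eq {d k l : ℤ} (h0 : 0 ≤ k) (h1 : k < d) (h : d ∣ l - k) :
    ⌊(l : ℝ) / d⌋ = (l - k) / d := by
  obtain ⟨i, hi⟩ := h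
  have hd : 0 < d := h0.trans_lt h1
  have hd' : (0 : ℝ) < d := by exact_mod_cast hd
  have hl : l = k + d * i := by linarith
  rw [hi, Int.mul_ediv_cancel_left _ hd.ne', Int.floor_eq_iff, le_div_iff₀ hd', div_lt_iff₀ hd', hl]
  have h0' : (0 : ℝ) ≤ k := by exact_mod_cast h0
  have h1' : (k : ℝ) < d := by exact_mod_cast h1
  push_cast
  constructor <;> nlinarith

section Count

variable {p q : ℤ} (hp : 0 < p) (hpq : p < q) {y x₁ x₂ : Torus} (hy0 : y ∈ lag 0) (hyq : y ∈ lag q)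
  (hx₁0 : x₁ ∈ lag 0) (hx₁p : x₁ ∈ lag p) (hx₂p : x₂ ∈ lag p) {k k₁ k₂ : ℤ}
  (hk : (((k : ℝ) / q : ℝ) : UnitAddCircle) = y.1)
  (hk₁ : (((k₁ : ℝ) / p : ℝ) : UnitAddCircle) = x₁.1)
  (hk₂ : (((k₂ : ℝ) / (q - p : ℤ) : ℝ) : UnitAddCircle) = x₂.1)

include hp hpq hy0 hk hk₁ hk₂

/-- The vertices of the lift of a triangle that starts at `(k / q, 0)` are determined by one integer
`l`: the first coordinates of the other two are `l / p` and `(k - l) / (q - p)`. -/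
theorem exists_vertex_data (T : HolTriangle (lag 0) (lag p) (lag q) y x₁ x₂) :
    ∃ (l : ℤ) (F : C(Disk, ℂ)), (∀ w, cover (F w) = T.u w) ∧ F (vertex 0) = ((k : ℝ) / q : ℝ) ∧
      (F (vertex 1)).re = (l : ℝ) / p ∧ (F (vertex 2)).re = ((k - l : ℤ) : ℝ) / (q - p : ℤ) ∧
      p ∣ l - k₁ ∧ q - p ∣ k - l - k₂ := by
  have hp' : (0 : ℝ) < p := by exact_mod_cast hp
  have hpq' : (p : ℝ) < q := by exact_mod_cast hpq
  have hd' : (0 : ℝ) < q - p := sub_pos.mpr hpq'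
  have hyc : cover (((k : ℝ) / q : ℝ) : ℂ) = y := by
    rw [exists_lift_mem_lag hy0 hk]
    simp [cover]
  obtain ⟨F, h0, hF⟩ := exists_lift T.u (w₀ := (((k : ℝ) / q : ℝ) : ℂ)) (by rw [hyc, T.vertex_zero])
  have hlift := lift_eq_modelLift hp hpq T hF h0
  have h1 : ((F (vertex 1)).re : UnitAddCircle) = x₁.1 := by
    rw [← T.vertex_one, ← hF]
    rfl
  have h2 : ((F (vertex 2)).re : UnitAddCircle) = x₂.1 := by
    rw [← T.vertex_two, ← hF]
    rfl
  rw [← hk₁] at h1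
  rw [← hk₂] at h2
  obtain ⟨i, hi⟩ := coe_eq_coe_iff.mp h1
  obtain ⟨j, hj⟩ := coe_eq_coe_iff.mp h2
  have hl1 : (F (vertex 1)).re = ((k₁ + p * i : ℤ) : ℝ) / p := by
    rw [hi]
    push_cast
    field_simp
  have hv2 := hlift (vertex 2)
  have e1 := modelLift_line_one hp' hpq' ((k : ℝ) / q) (F (vertex 1)).re (s := 2 / 3)
    ⟨by norm_num, le_rfl⟩
  have e2 := modelLift_line_two hp' hpq' ((k : ℝ) / q) (F (vertex 1)).re (s := 2 / 3)
    ⟨le_rfl, by norm_num⟩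
  rw [vertex_apply 2, show (((2 : Fin 3) : ℕ) : ℝ) / 3 = 2 / 3 by simp] at hv2 hj ⊢
  rw [← hv2] at e1 e2
  have hkq : (q : ℝ) * (k / q) = k := mul_div_cancel₀ _ (hp'.trans hpq').ne'
  have hp1 : (p : ℝ) * (F (vertex 1)).re = (k₁ + p * i : ℤ) := by
    rw [hl1, mul_div_cancel₀ _ hp'.ne']
  have hrel : ((q : ℝ) - p) * (F (bdryPt (2 / 3))).re = (k - (k₁ + p * i) : ℤ) := by
    rw [hkq] at e2
    rw [hp1] at e1
    push_cast at e1 ⊢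
    linarith
  refine ⟨k₁ + p * i, F, hF, h0, hl1, ?_, ⟨i, by ring⟩, j, ?_⟩
  · rw [← hrel]
    push_cast
    rw [mul_div_cancel_left₀ _ hd'.ne']
  · have h3 : ((k - (k₁ + p * i) : ℤ) : ℝ) = (k₂ + (q - p) * j : ℤ) := by
      rw [← hrel, hj]
      push_cast
      field_simp
    have h4 : k - (k₁ + p * i) = k₂ + (q - p) * j := by exact_mod_cast h3
    linarith

include hyq hx₁0 hx₁p hx₂p

/-- The holomorphic triangles with given vertices are indexed by the integers `l` that contribute to
the coefficient of `z ^ k` in a product of two theta series, and the contributions agree. -/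
theorem exists_triangle_index {C : Type*} [CommRing C] (σ : C ≃+* C) {ε : ℝ} (hε : Irrational ε)
    (h0k : 0 ≤ k) (hkq : k < q) (h0k₁ : 0 ≤ k₁) (hk₁p : k₁ < p) (h0k₂ : 0 ≤ k₂) (hk₂p : k₂ < q - p)
    (b a : C) :
    ∃ ℓ : HolTriangle (lag 0) (lag p) (lag q) y x₁ x₂ → ℤ, Function.Injective ℓ ∧
      (∀ T, triangleTerm σ ε 0 p q b a T = theta σ p k₁ a (ℓ T) * theta σ (q - p) k₂ b (k - ℓ T)) ∧
      ∀ l, l ∉ Set.range ℓ → theta σ p k₁ a l * theta σ (q - p) k₂ b (k - l) = 0 := by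
  have hp' : (0 : ℝ) < p := by exact_mod_cast hp
  have hpq' : (p : ℝ) < q := by exact_mod_cast hpq
  have hd' : (0 : ℝ) < q - p := sub_pos.mpr hpq'
  have hdata := exists_vertex_data (x₂ := x₂) hp hpq hy0 hk hk₁ hk₂
  choose ℓ F hF h0 h1 h2 hd1 hd2 using hdata
  refine ⟨ℓ, ?_, ?_, ?_⟩
  · intro T T' hTT
    refine HolTriangle.ext_u (ContinuousMap.ext fun w => ?_)
    rw [← hF, ← hF, lift_eq_modelLift hp hpq T (hF T) (h0 T),
      lift_eq_modelLift hp hpq T' (hF T') (h0 T'), h1, h1, hTT]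
  · intro T
    have hs := sign_eq_one hp hpq hε T (hF T) (h0 T) (h1 T) (h2 T)
    have hfl : ⌊(F T (vertex 0)).re⌋ = 0 := by
      rw [h0, Complex.ofReal_re, floor_div_eq h0k hkq (by simp)]
      simp
    rw [triangleTerm_eq σ T hs (hF T) hfl, h1, h2, floor_div_eq h0k₁ hk₁p (hd1 T),
      floor_div_eq h0k₂ hk₂p (hd2 T), theta, theta, if_pos (hd1 T), if_pos (hd2 T)]
  · intro l hl
    by_contra hne
    refine hl ?_
    have hl1 : p ∣ l - k₁ := by
      by_contra h
      exact hne (by rw [theta, if_neg h, zero_mul])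
    have hl2 : q - p ∣ k - l - k₂ := by
      by_contra h
      exact hne (by rw [theta, theta, if_neg h, mul_zero])
    obtain ⟨i, hi⟩ := hl1
    obtain ⟨j, hj⟩ := hl2
    have e1 : (((l : ℝ) / p : ℝ) : UnitAddCircle) = x₁.1 := by
      rw [← hk₁]
      refine coe_eq_coe_iff.mpr ⟨i, ?_⟩
      have : (l : ℝ) = k₁ + p * i := by exact_mod_cast eq_add_of_sub_eq' hi
      rw [this]
      field_simp
    have e2 : ((((k - l : ℤ) : ℝ) / (q - p : ℤ) : ℝ) : UnitAddCircle) = x₂.1 := by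
      rw [← hk₂]
      refine coe_eq_coe_iff.mpr ⟨j, ?_⟩
      rw [show k - l = k₂ + (q - p) * j by linarith]
      push_cast
      field_simp
    -- A nonzero term comes from the model triangle with first coordinates `k / q`, `l / p` and
    -- `(k - l) / (q - p)`.
    obtain ⟨T, hT⟩ := exists_holTriangle hp hpq (X₀ := (k : ℝ) / q) (X₁ := (l : ℝ) / p)
      (X₂ := ((k - l : ℤ) : ℝ) / (q - p : ℤ)) (y := y) (x₁ := x₁) (x₂ := x₂)
      (by rw [exists_lift_mem_lag hy0 hk]; simp [cover])
      (by rw [exists_lift_mem_lag hx₁0 e1]; simp [cover])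
      (by
        rw [exists_lift_mem_lag hx₂p e2, cover_eq_cover_iff]
        refine ⟨⟨0, by simp⟩, l, ?_⟩
        dsimp only
        rw [mul_div_cancel₀ _ hp'.ne'])
      (by
        push_cast
        rw [mul_div_cancel₀ _ hp'.ne', mul_div_cancel₀ _ hd'.ne',
          mul_div_cancel₀ _ (hp'.trans hpq').ne']
        ring) hyq hx₁p
    refine ⟨T, ?_⟩
    have hFm : F T = ⟨fun w : Disk => modelLift p q ((k : ℝ) / q) ((l : ℝ) / p) w,
        (continuousOn_modelLift hp' hpq' _ _).comp_continuous continuous_subtype_val fun w => w.2⟩ := by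
      refine lift_unique (fun w => ?_) ?_
      · rw [hF, hT]
        rfl
      · rw [h0]
        change _ = modelLift p q ((k : ℝ) / q) ((l : ℝ) / p) (vertex 0)
        rw [vertex_apply, show (((0 : Fin 3) : ℕ) : ℝ) / 3 = 0 by simp, modelLift_bdryPt_zero]
    have h3 := h1 T
    rw [hFm] at h3
    change (modelLift p q ((k : ℝ) / q) ((l : ℝ) / p) (vertex 1)).re = _ at h3
    rw [vertex_apply, show (((1 : Fin 3) : ℕ) : ℝ) / 3 = 1 / 3 by simp,
      modelLift_bdryPt_third hp' hpq', Complex.ofReal_re, div_left_inj' hp'.ne'] at h3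
    exact_mod_cast h3.symm

end Count

/-! ### Theta series as elements of the Fargues–Fontaine ring -/

section Theta

variable {C : Type*} [CommRing C]

theorem theta_add (σ : C ≃+* C) (m k : ℤ) (a b : C) (j : ℤ) :
    theta σ m k (a + b) j = theta σ m k a j + theta σ m k b j := by
  unfold theta
  split_ifs
  · exact map_add _ _ _
  · rw [add_zero]

theorem theta_zero (σ : C ≃+* C) (m k : ℤ) (j : ℤ) : theta σ m k 0 j = 0 := by
  unfold theta
  split_ifs
  · exact map_zero _
  · rfl

variable (p : ℕ) [ExpChar C p] [PerfectRing C p]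

theorem pthRoot_pow (a : C) : (pthRoot C p a) ^ p = a := frobeniusEquiv_symm_pow_p C p a

theorem pthRoot_zpow_pow (i : ℤ) (a : C) :
    (((pthRoot C p : RingAut C) ^ i) a) ^ p = ((pthRoot C p : RingAut C) ^ (i - 1)) a := by
  have h : (pthRoot C p : RingAut C) ^ i = pthRoot C p * (pthRoot C p : RingAut C) ^ (i - 1) := by
    rw [← zpow_one_add]
    congr 1
    ring
  rw [h, RingAut.mul_apply]
  exact pthRoot_pow p _

theorem theta_pow (hp : p ≠ 0) (m k : ℤ) (hm : m ≠ 0) (a : C) (j : ℤ) :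
    (theta (pthRoot C p) m k a j) ^ p = theta (pthRoot C p) m k a (j - m) := by
  unfold theta
  have h : m ∣ j - m - k ↔ m ∣ j - k := by
    rw [show j - m - k = j - k - m by ring]
    exact dvd_sub_self_right
  by_cases hd : m ∣ j - k
  · rw [if_pos hd, if_pos (h.mpr hd), pthRoot_zpow_pow]
    congr 2
    rw [show j - m - k = j - k + m * (-1) by ring, Int.add_mul_ediv_left _ _ hm]
    ring
  · rw [if_neg hd, if_neg (mt h.mp hd), zero_pow hp]

end Theta

section Norm

theorem norm_pthRoot_zpow_pow (p : ℕ) {C : Type*} [NontriviallyNormedField C] [ExpChar C p]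
    [PerfectRing C p] (i : ℤ) (a : C) :
    ‖((pthRoot C p : RingAut C) ^ i) a‖ ^ p = ‖((pthRoot C p : RingAut C) ^ (i - 1)) a‖ := by
  rw [← norm_pow, pthRoot_zpow_pow]

variable (p : ℕ) [Fact p.Prime] {C : Type*} [NontriviallyNormedField C] [ExpChar C p]
  [PerfectRing C p]

theorem norm_pthRoot_zpow_lt_one (i : ℤ) {a : C} (ha : ‖a‖ < 1) :
    ‖((pthRoot C p : RingAut C) ^ i) a‖ < 1 := by
  have hp : p ≠ 0 := (Fact.out : p.Prime).ne_zero
  induction i using Int.induction_on with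
  | zero => simpa using ha
  | succ i ih =>
    have h := norm_pthRoot_zpow_pow p ((i : ℤ) + 1) a
    rw [add_sub_cancel_right] at h
    rw [← h] at ih
    exact (pow_lt_one_iff_of_nonneg (norm_nonneg _) hp).mp ih
  | pred i ih =>
    rw [← norm_pthRoot_zpow_pow]
    exact pow_lt_one₀ (norm_nonneg _) ih hp

theorem norm_pthRoot_neg_le (a : C) (ha : ‖a‖ < 1) (t : ℕ) :
    ‖((pthRoot C p : RingAut C) ^ (-(t : ℤ))) a‖ ≤ ‖a‖ ^ (t + 1 : ℕ) := by
  have hp : 2 ≤ p := (Fact.out : p.Prime).two_le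
  induction t with
  | zero => simp
  | succ t ih =>
    have h := norm_pthRoot_zpow_pow p (-(t : ℤ)) a
    rw [show -(t : ℤ) - 1 = -((t + 1 : ℕ) : ℤ) by push_cast; ring] at h
    rw [← h]
    calc ‖((pthRoot C p : RingAut C) ^ (-(t : ℤ))) a‖ ^ p
        ≤ ‖((pthRoot C p : RingAut C) ^ (-(t : ℤ))) a‖ ^ 2 :=
          pow_le_pow_of_le_one (norm_nonneg _) (norm_pthRoot_zpow_lt_one p _ ha).le hp
      _ ≤ (‖a‖ ^ (t + 1)) ^ 2 := pow_le_pow_left₀ (norm_nonneg _) ih 2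
      _ = ‖a‖ ^ ((t + 1) * 2) := (pow_mul _ _ _).symm
      _ ≤ ‖a‖ ^ (t + 1 + 1) := pow_le_pow_of_le_one (norm_nonneg _) ha.le (by omega)

/-- The theta series of `a` lies in `B` when `|a| < 1`: towards `+∞` its coefficients are bounded,
and towards `-∞` they are the iterated `p`-th powers of `a`, which beat every geometric growth. -/
theorem inB_theta {m : ℤ} (hm : 0 < m) (k : ℤ) {a : C} (ha : ‖a‖ < 1) :
    InB C (theta (pthRoot C p) m k a) := by
  refine InB.of_summable fun r h0 h1 => ?_
  have hinj : Function.Injective fun i : ℤ => m * i + k := fun i j h => by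
    simpa [hm.ne'] using h
  rw [← hinj.summable_iff]
  · have e : ((fun i : ℤ => ‖theta (pthRoot C p) m k a i‖ * r ^ i) ∘ fun i : ℤ => m * i + k) =
        fun i : ℤ => r ^ k * (‖((pthRoot C p : RingAut C) ^ i) a‖ * (r ^ m) ^ i) := by
      funext i
      simp only [Function.comp_apply, theta, add_sub_cancel_right, dvd_mul_right, if_true]
      rw [Int.mul_ediv_cancel_left _ hm.ne', zpow_add₀ h0.ne', zpow_mul]
      ring
    rw [e]
    refine Summable.mul_left _ (Summable.of_nat_of_neg ?_ ?_)
    · have hr : r ^ m < 1 := by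
        lift m to ℕ using hm.le
        rw [zpow_natCast]
        exact pow_lt_one₀ h0.le h1 (by simpa using hm.ne')
      refine Summable.of_nonneg_of_le (fun t => by positivity) (fun t => ?_)
        (summable_geometric_of_lt_one (by positivity) hr)
      rw [zpow_natCast (r ^ m)]
      exact mul_le_of_le_one_left (by positivity) (norm_pthRoot_zpow_lt_one p _ ha).le
    · -- The ratio of consecutive terms is at most `|a| ^ (t + 1) r ^ (-m)`, which tends to zero.
      have hlim : Tendsto (fun t : ℕ => ‖a‖ ^ (t + 1) * (r ^ m)⁻¹) atTop (𝓝 0) := by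
        have := ((tendsto_pow_atTop_nhds_zero_of_lt_one (norm_nonneg a) ha).comp
          (tendsto_add_atTop_nat 1)).mul_const (r ^ m)⁻¹
        rwa [zero_mul] at this
      refine summable_of_ratio_norm_eventually_le (r := 1 / 2) (by norm_num) ?_
      filter_upwards [hlim.eventually_le_const (show (0 : ℝ) < 1 / 2 by norm_num)] with t ht
      have hle := norm_pthRoot_neg_le p a ha t
      set x := ‖((pthRoot C p : RingAut C) ^ (-(t : ℤ))) a‖ with hx
      have hx0 : 0 ≤ x := norm_nonneg _
      have hx1 : x < 1 := norm_pthRoot_zpow_lt_one p _ ha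
      have hnext := norm_pthRoot_zpow_pow p (-(t : ℤ)) a
      rw [show -(t : ℤ) - 1 = -((t + 1 : ℕ) : ℤ) by push_cast; ring, ← hx] at hnext
      rw [← hnext]
      have hxp : x ^ p ≤ ‖a‖ ^ (t + 1) * x := by
        calc x ^ p ≤ x ^ 2 := pow_le_pow_of_le_one hx0 hx1.le (Fact.out : p.Prime).two_le
          _ = x * x := sq x
          _ ≤ ‖a‖ ^ (t + 1) * x := mul_le_mul_of_nonneg_right hle hx0
      have hrt : (r ^ m) ^ (-((t + 1 : ℕ) : ℤ)) = (r ^ m)⁻¹ * (r ^ m) ^ (-(t : ℤ)) := by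
        rw [← zpow_neg_one, ← zpow_add₀ (by positivity)]
        congr 1
        push_cast
        ring
      rw [Real.norm_of_nonneg (by positivity), Real.norm_of_nonneg (by positivity), hrt]
      calc x ^ p * ((r ^ m)⁻¹ * (r ^ m) ^ (-(t : ℤ)))
          ≤ (‖a‖ ^ (t + 1) * x) * ((r ^ m)⁻¹ * (r ^ m) ^ (-(t : ℤ))) :=
            mul_le_mul_of_nonneg_right hxp (by positivity)
        _ = (‖a‖ ^ (t + 1) * (r ^ m)⁻¹) * (x * (r ^ m) ^ (-(t : ℤ))) := by ring
        _ ≤ 1 / 2 * (x * (r ^ m) ^ (-(t : ℤ))) := mul_le_mul_of_nonneg_right ht (by positivity)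
  · intro j hj
    have : ¬ m ∣ j - k := by
      rintro ⟨i, hi⟩
      exact hj ⟨i, by dsimp only; linarith⟩
    rw [theta, if_neg this, norm_zero, zero_mul]

end Norm

/-! ### The intersection points -/

section IntPt

variable (n : ℕ+)

theorem intPt_fst (k : ℕ) : ((intPt n k : ↥(lag 0 ∩ lag (n : ℕ))) : Torus).1 =
    (((k : ℝ) / (n : ℕ) : ℝ) : UnitAddCircle) := rfl

theorem ext_fst {x x' : ↥(lag 0 ∩ lag (n : ℕ))} (h : (x : Torus).1 = (x' : Torus).1) : x = x' := by
  obtain ⟨s, -, hs⟩ := AddCircle.eq_coe_Ico (x : Torus).1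
  apply Subtype.ext
  rw [exists_lift_mem_lag x.2.1 hs, exists_lift_mem_lag x'.2.1 (hs.trans h)]

theorem exists_intPt (x : ↥(lag 0 ∩ lag (n : ℕ))) : ∃ k : ℕ, k < n ∧ intPt n k = x := by
  obtain ⟨k, h0, h1, hk⟩ := exists_fst_eq (a := 0) (b := (n : ℕ)) (d := (n : ℕ))
    (by exact_mod_cast n.pos) (by simp) x.2.1 x.2.2
  lift k to ℕ using h0
  refine ⟨k, by exact_mod_cast h1, ext_fst n ?_⟩
  rw [intPt_fst, ← hk]
  simp

variable {n} in
theorem intPt_injOn {k k' : ℕ} (hk : k < n) (hk' : k' < n)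
    (h : intPt n k = intPt n k') : k = k' := by
  have hn : (0 : ℝ) < (n : ℕ) := by exact_mod_cast n.pos
  have h1 := congrArg (fun x : ↥(lag 0 ∩ lag (n : ℕ)) => (x : Torus).1) h
  simp only [intPt_fst] at h1
  have e : ∀ i : ℕ, i < n → ((i : ℝ) / (n : ℕ)) ∈ Set.Ico (0 : ℝ) (0 + 1) := by
    intro i hi
    refine ⟨by positivity, ?_⟩
    rw [zero_add, div_lt_one hn]
    exact_mod_cast hi
  have h2 := (AddCircle.coe_eq_coe_iff_of_mem_Ico (e k hk) (e k' hk')).mp h1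
  rw [div_left_inj' hn.ne'] at h2
  exact_mod_cast h2

variable {n} in
/-- The integer `0 ≤ k < n` such that the given point of `L_(0) ∩ L_(n)` is `(k / n, 0)`. -/
def ptIndex (x : ↥(lag 0 ∩ lag (n : ℕ))) : ℕ := (exists_intPt n x).choose

variable {n} in
theorem ptIndex_lt (x : ↥(lag 0 ∩ lag (n : ℕ))) : ptIndex x < n := (exists_intPt n x).choose_spec.1

variable {n} in
theorem intPt_ptIndex (x : ↥(lag 0 ∩ lag (n : ℕ))) : intPt n (ptIndex x) = x :=
  (exists_intPt n x).choose_spec.2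

variable {n} in
theorem ptIndex_intPt {k : ℕ} (hk : k < n) : ptIndex (intPt n k) = k :=
  intPt_injOn (ptIndex_lt _) hk (intPt_ptIndex _)

instance : Finite ↥(lag 0 ∩ lag (n : ℕ)) :=
  Finite.of_injective (fun x => (⟨ptIndex x, ptIndex_lt x⟩ : Fin n)) fun x x' h => by
    rw [← intPt_ptIndex x, ← intPt_ptIndex x']
    congr 1
    exact congrArg Fin.val h

end IntPt

/-! ### Floer cochains as eigenvectors of Frobenius -/

section ThetaHom

theorem mem_eigen_iff (p : ℕ) [Fact p.Prime] {C : Type*} [NontriviallyNormedField C]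
    [CompleteSpace C] [CharP C p] {n : ℕ} {f : B C} :
    f ∈ eigen C p n ↔ ∀ j : ℤ, f.coeff j ^ p = f.coeff (j - n) := by
  have hz : ∀ (n : ℕ) (f : B C) (j : ℤ), (B.z C ^ n * f).coeff j = f.coeff (j - n) := by
    intro n
    induction n with
    | zero => intro f j; simp
    | succ n ih =>
      intro f j
      rw [pow_succ, mul_assoc, ih]
      refine (single_conv 1 1 f.coeff (j - n)).trans ?_
      rw [one_mul]
      congr 1
      push_cast
      ring
  change B.phi C p f = B.z C ^ n * f ↔ _
  constructor
  · intro h j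
    rw [← hz, ← h]
    rfl
  · intro h
    refine B.ext (funext fun j => ?_)
    rw [hz, ← h]
    rfl

/-- The coefficients of an eigenvector lie in `𝔪`: the iterated `p`-th powers of a coefficient of
absolute value at least `1` recur towards `-∞` and violate the growth condition. -/
theorem norm_coeff_lt_one (p : ℕ) [Fact p.Prime] {C : Type*} [NontriviallyNormedField C]
    [CompleteSpace C] [CharP C p] {n : ℕ+} {f : B C} (hf : f ∈ eigen C p n) (j : ℤ) :
    ‖f.coeff j‖ < 1 := by
  rw [mem_eigen_iff] at hf
  by_contra hge
  rw [not_lt] at hge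
  have h : ∀ t : ℕ, 1 ≤ ‖f.coeff (j - (n : ℕ) * t)‖ := by
    intro t
    induction t with
    | zero => simpa using hge
    | succ t ih =>
      rw [show j - (n : ℕ) * ((t + 1 : ℕ) : ℤ) = j - (n : ℕ) * t - (n : ℕ) by push_cast; ring, ← hf,
        norm_pow]
      exact one_le_pow₀ ih
  have hlim : Tendsto (fun i : ℤ => ‖f.coeff i‖ * (1 / 2 : ℝ) ^ i) cofinite (𝓝 0) :=
    f.2 (1 / 2) (by norm_num) (by norm_num)
  have hpos : (0 : ℝ) < (1 / 2) ^ j := by positivity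
  have hfin : {i : ℤ | ¬ ‖f.coeff i‖ * (1 / 2 : ℝ) ^ i < (1 / 2) ^ j}.Finite :=
    eventually_cofinite.mp (hlim.eventually_lt_const hpos)
  have hn : (0 : ℤ) < (n : ℕ) := by exact_mod_cast n.pos
  have hinj : Function.Injective fun t : ℕ => j - ((n : ℕ) : ℤ) * t := by
    intro s t hst
    have : ((n : ℕ) : ℤ) * s = (n : ℕ) * t := by
      dsimp only at hst
      linarith
    exact_mod_cast mul_left_cancel₀ hn.ne' this
  refine Set.infinite_range_of_injective hinj (hfin.subset ?_)
  rintro _ ⟨t, rfl⟩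
  rw [Set.mem_ofPred_eq, not_lt]
  have h1 : (1 / 2 : ℝ) ^ j ≤ (1 / 2 : ℝ) ^ (j - ((n : ℕ) : ℤ) * t) :=
    zpow_le_zpow_right_of_le_one₀ (by norm_num) (by norm_num) (by
      have : 0 ≤ ((n : ℕ) : ℤ) * t := by positivity
      linarith)
  calc (1 / 2 : ℝ) ^ j ≤ (1 / 2 : ℝ) ^ (j - ((n : ℕ) : ℤ) * t) := h1
    _ ≤ _ := le_mul_of_one_le_left (by positivity) (h t)

theorem coeff_eigen_eq (p : ℕ) [Fact p.Prime] {C : Type*} [NontriviallyNormedField C]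
    [CompleteSpace C] [CharP C p] [PerfectRing C p] {n : ℕ+} {f : B C} (hf : f ∈ eigen C p n)
    (k i : ℤ) :
    f.coeff (k + (n : ℕ) * i) = ((pthRoot C p : RingAut C) ^ i) (f.coeff k) := by
  rw [mem_eigen_iff] at hf
  have hp : Function.Injective fun a : C => a ^ p := frobenius_inj C p
  induction i using Int.induction_on with
  | zero => simp
  | succ i ih =>
    apply hp
    dsimp only
    rw [hf, pthRoot_zpow_pow, add_sub_cancel_right, ← ih]
    congr 1
    ring
  | pred i ih =>
    rw [← pthRoot_zpow_pow, ← ih, hf]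
    congr 1
    ring

variable (p : ℕ) [Fact p.Prime] (C : Type*) [NontriviallyNormedField C] [IsUltrametricDist C]
  [CompleteSpace C] [CharP C p] [PerfectRing C p]

/-- The homomorphism `a ↦ ∑ z ^ (n i + k) σ ^ i (a)` from `𝔪` to `B^{φ = z ^ n}`. -/
def thetaHom (n : ℕ+) (k : ℕ) : maxIdeal C →+ eigen C p n where
  toFun a := ⟨⟨theta (pthRoot C p) (n : ℕ) k a,
      inB_theta p (by exact_mod_cast n.pos) k a.2⟩,
    (mem_eigen_iff p).mpr fun j => theta_pow p (Fact.out : p.Prime).ne_zero _ _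
      (by exact_mod_cast n.ne_zero) _ _⟩
  map_zero' := Subtype.ext (B.ext (funext fun j => theta_zero _ _ _ _))
  map_add' a b := Subtype.ext (B.ext (funext fun j => theta_add _ _ _ _ _ _))

variable {C} in
theorem coeff_thetaHom (n : ℕ+) (k : ℕ) (a : maxIdeal C) :
    (thetaHom p C n k a : B C).coeff = theta (pthRoot C p) (n : ℕ) k a := rfl

/-- The homomorphism `CF(L_(0), L_(n); 𝔪) → B^{φ = z ^ n}` that sends `x_{n,k/n} · a` to the theta
series of `a`. -/
def cfHom (n : ℕ+) : CFm C n →+ eigen C p n :=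
  Finsupp.liftAddHom fun x => thetaHom p C n (ptIndex x)

variable {C}

/-- A coefficient as an additive map. -/
def coeffHom (j : ℤ) : B C →+ C where
  toFun f := f.coeff j
  map_zero' := rfl
  map_add' _ _ := rfl

theorem cfHom_single (n : ℕ+) (x : ↥(lag 0 ∩ lag (n : ℕ))) (a : maxIdeal C) :
    cfHom p C n (Finsupp.single x a) = thetaHom p C n (ptIndex x) a := by
  rw [cfHom, Finsupp.liftAddHom_apply_single]

/-- Every coefficient of the series of a cochain is a twist of the cochain's value at one intersection
point. -/
theorem coeff_cfHom (n : ℕ+) (α : CFm C n) (j : ℤ) : (cfHom p C n α : B C).coeff j =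
    ((pthRoot C p : RingAut C) ^ (j / (n : ℕ))) (α (intPt n (j % (n : ℕ)).toNat)) := by
  have hn : (0 : ℤ) < (n : ℕ) := by exact_mod_cast n.pos
  set k := (j % (n : ℕ)).toNat with hk
  have hkj : (k : ℤ) = j % (n : ℕ) := Int.toNat_of_nonneg (Int.emod_nonneg _ hn.ne')
  have hkn : k < n := by
    have := Int.emod_lt_of_pos j hn
    rw [← hkj] at this
    exact_mod_cast this
  induction α using Finsupp.induction_linear with
  | zero => simp; rfl
  | add f g hf hg =>
    rw [map_add, Finsupp.add_apply, AddSubgroup.coe_add, AddSubgroup.coe_add, map_add, ← hf, ← hg]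
    rfl
  | single x a =>
    rw [cfHom_single, coeff_thetaHom, theta]
    have hx := ptIndex_lt x
    have hdvd : ((n : ℕ) : ℤ) ∣ j - ptIndex x ↔ k = ptIndex x := by
      constructor
      · intro h
        have h1 := (Int.emod_emod_of_dvd j (dvd_refl ((n : ℕ) : ℤ)))
        have h2 := (Int.emod_eq_emod_iff_emod_sub_eq_zero).mpr (Int.emod_eq_zero_of_dvd h)
        rw [← hkj, Int.emod_eq_of_lt (by positivity) (by exact_mod_cast hx)] at h2
        exact_mod_cast h2
      · intro h
        rw [← h, hkj]
        exact Int.dvd_self_sub_emod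
    by_cases h : k = ptIndex x
    · rw [if_pos (hdvd.mpr h)]
      have e : (j - ptIndex x) / (n : ℕ) = j / (n : ℕ) := by
        rw [← h, hkj]
        have h1 := Int.mul_ediv_add_emod j (n : ℕ)
        rw [show j - j % (n : ℕ) = (n : ℕ) * (j / (n : ℕ)) by linarith,
          Int.mul_ediv_cancel_left _ hn.ne']
      rw [e, h, intPt_ptIndex, Finsupp.single_eq_same]
    · rw [if_neg (mt hdvd.mp h), Finsupp.single_eq_of_ne]
      · simp
      · intro hx'
        exact h (by rw [← hx', ptIndex_intPt hkn])

theorem coeff_cfHom_natCast (n : ℕ+) (α : CFm C n) {k : ℕ} (hk : k < n) :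
    (cfHom p C n α : B C).coeff k = α (intPt n k) := by
  have h1 : (k : ℤ) / (n : ℕ) = 0 := Int.ediv_eq_zero_of_lt (by positivity) (by exact_mod_cast hk)
  have h2 : (k : ℤ) % (n : ℕ) = k := Int.emod_eq_of_lt (by positivity) (by exact_mod_cast hk)
  rw [coeff_cfHom, h1, h2]
  simp

theorem cfHom_bijective (n : ℕ+) : Function.Bijective (cfHom p C n) := by
  have hn : (0 : ℤ) < (n : ℕ) := by exact_mod_cast n.pos
  constructor
  · intro α β h
    ext x
    have h1 := coeff_cfHom_natCast p n α (ptIndex_lt x)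
    rw [h, coeff_cfHom_natCast p n β (ptIndex_lt x), intPt_ptIndex] at h1
    exact h1.symm
  · intro f
    refine ⟨Finsupp.equivFunOnFinite.symm fun x =>
      ⟨(f : B C).coeff (ptIndex x), norm_coeff_lt_one p f.2 _⟩, ?_⟩
    refine Subtype.ext (B.ext (funext fun j => ?_))
    have hkj : ((j % (n : ℕ)).toNat : ℤ) = j % (n : ℕ) :=
      Int.toNat_of_nonneg (Int.emod_nonneg _ hn.ne')
    have hkn : (j % (n : ℕ)).toNat < n := by
      have := Int.emod_lt_of_pos j hn
      rw [← hkj] at this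
      exact_mod_cast this
    rw [coeff_cfHom]
    simp only [Finsupp.equivFunOnFinite_symm_apply_apply]
    rw [ptIndex_intPt hkn, ← coeff_eigen_eq p f.2, hkj, add_comm, Int.mul_ediv_add_emod]

/-- The isomorphism `CF(L_(0), L_(n); 𝔪) ≅ B^{φ = z ^ n}`. -/
def cfEquiv (n : ℕ+) : CFm C n ≃+ eigen C p n :=
  AddEquiv.ofBijective (cfHom p C n) (cfHom_bijective p n)

end ThetaHom

/-! ### Comparison of the triangle product with the product of series -/

section Product

theorem triangleTerm_zero_left {C : Type*} [CommRing C] (σ : C ≃+* C) (ε : ℝ) (m₀ m₁ m₂ : ℤ)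
    {y x₁ x₂ : Torus} (a : C) (T : HolTriangle (lag m₀) (lag m₁) (lag m₂) y x₁ x₂) :
    triangleTerm σ ε m₀ m₁ m₂ 0 a T = 0 := by
  simp [triangleTerm]

theorem triangleTerm_zero_right {C : Type*} [CommRing C] (σ : C ≃+* C) (ε : ℝ) (m₀ m₁ m₂ : ℤ)
    {y x₁ x₂ : Torus} (b : C) (T : HolTriangle (lag m₀) (lag m₁) (lag m₂) y x₁ x₂) :
    triangleTerm σ ε m₀ m₁ m₂ b 0 T = 0 := by
  simp [triangleTerm]

theorem map_finsuppSum_mul_finsuppSum {ι κ M N R S : Type*} [Zero M] [Zero N]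
    [NonUnitalNonAssocSemiring R] [AddCommMonoid S] (c : R →+ S) (β : ι →₀ M) (α : κ →₀ N)
    (f : ι → M → R) (g : κ → N → R) :
    c (β.sum f * α.sum g) = β.sum fun i b => α.sum fun j a => c (f i b * g j a) := by
  simp only [Finsupp.sum, Finset.sum_mul, Finset.mul_sum, map_sum]
  exact Finset.sum_comm

theorem dehn_injective (k : ℤ) : Function.Injective (dehn k) := by
  intro x x' h
  obtain ⟨h1, h2⟩ := Prod.mk.inj h
  rw [h1, sub_left_inj] at h2
  exact Prod.ext h1 h2

/-- The contributions of the triangles with given vertices are summable, and their sum is a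
coefficient of the product of two theta series. -/
theorem hasSum_triangleTerm (p : ℕ) [Fact p.Prime] {C : Type*} [NontriviallyNormedField C]
    [CompleteSpace C] [CharP C p] [PerfectRing C p] {ε : ℝ} (hε : Irrational ε)
    {m n q : ℤ} (hm : 0 < m) (hn : 0 < n) (hq : q = m + n) {y x₁ x₂ : Torus}
    (hy0 : y ∈ lag 0) (hyq : y ∈ lag q) (hx₁0 : x₁ ∈ lag 0) (hx₁m : x₁ ∈ lag m) (hx₂m : x₂ ∈ lag m)
    {k k₁ k₂ : ℤ} (hk : (((k : ℝ) / q : ℝ) : UnitAddCircle) = y.1)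
    (hk₁ : (((k₁ : ℝ) / m : ℝ) : UnitAddCircle) = x₁.1)
    (hk₂ : (((k₂ : ℝ) / n : ℝ) : UnitAddCircle) = x₂.1)
    (h0k : 0 ≤ k) (hkq : k < q) (h0k₁ : 0 ≤ k₁) (hk₁m : k₁ < m) (h0k₂ : 0 ≤ k₂) (hk₂n : k₂ < n)
    {b a : C} (hb : ‖b‖ < 1) (ha : ‖a‖ < 1) :
    HasSum (fun T : HolTriangle (lag 0) (lag m) (lag q) y x₁ x₂ =>
        triangleTerm (pthRoot C p) ε 0 m q b a T)
      (conv (theta (pthRoot C p) m k₁ a) (theta (pthRoot C p) n k₂ b) k) := by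
  have hqm : q - m = n := by rw [hq]; ring
  obtain ⟨ℓ, hinj, hterm, hzero⟩ := exists_triangle_index (p := m) (q := q) (y := y) (x₁ := x₁)
    (x₂ := x₂) hm (by linarith) hy0 hyq hx₁0 hx₁m hx₂m hk hk₁ (by rw [hqm]; exact hk₂)
    (pthRoot C p) hε h0k hkq h0k₁ hk₁m h0k₂ (by rw [hqm]; exact hk₂n) b a
  rw [hqm] at hterm hzero
  have hs := (InB.summable_coeff (inB_theta p hm k₁ ha) (inB_theta p hn k₂ hb) k).hasSum
  rw [← hinj.hasSum_iff hzero] at hs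
  exact hs.congr_fun fun T => hterm T

theorem summable_triangleTerm (p : ℕ) [Fact p.Prime] {C : Type*} [NontriviallyNormedField C]
    [CompleteSpace C] [CharP C p] [PerfectRing C p] {ε : ℝ} (hε : Irrational ε)
    (m n : ℕ+) (y : ↥(lag 0 ∩ lag ((m + n : ℕ+) : ℕ)))
    (x₂ : ↥(lag (m : ℕ) ∩ lag ((m + n : ℕ+) : ℕ))) (x₁ : ↥(lag 0 ∩ lag (m : ℕ))) {b a : C}
    (hb : ‖b‖ < 1) (ha : ‖a‖ < 1) :
    Summable fun T : HolTriangle (lag 0) (lag (m : ℕ)) (lag ((m + n : ℕ+) : ℕ)) y x₁ x₂ =>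
      triangleTerm (pthRoot C p) ε 0 (m : ℕ) ((m + n : ℕ+) : ℕ) b a T := by
  have hm : (0 : ℤ) < (m : ℕ) := by exact_mod_cast m.pos
  have hn : (0 : ℤ) < (n : ℕ) := by exact_mod_cast n.pos
  have hq : (((m + n : ℕ+) : ℕ) : ℤ) = (m : ℕ) + (n : ℕ) := by simp
  obtain ⟨k, h0k, hkq, hk⟩ :=
    exists_fst_eq (a := 0) (hq ▸ add_pos hm hn) (zero_add _).symm y.2.1 y.2.2
  obtain ⟨k₁, h0k₁, hk₁m, hk₁⟩ := exists_fst_eq (a := 0) hm (zero_add _).symm x₁.2.1 x₁.2.2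
  obtain ⟨k₂, h0k₂, hk₂n, hk₂⟩ := exists_fst_eq hn hq x₂.2.1 x₂.2.2
  exact (hasSum_triangleTerm p hε hm hn hq y.2.1 y.2.2 x₁.2.1 x₁.2.2 x₂.2.1 hk hk₁ hk₂ h0k hkq h0k₁
    hk₁m h0k₂ hk₂n hb ha).summable

variable (p : ℕ) [Fact p.Prime] {C : Type*} [NontriviallyNormedField C] [IsUltrametricDist C]
  [CompleteSpace C] [CharP C p] [PerfectRing C p] {ε : ℝ} (hε : Irrational ε)

include hε

/-- The triangle product computes the coefficients of the product of the associated series. -/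
theorem gradedProduct_eq_coeff {n₂ n₁ : ℕ+} (β : CFm C n₂) (α : CFm C n₁)
    (y : ↥(lag 0 ∩ lag ((n₂ + n₁ : ℕ+) : ℕ))) :
    gradedProduct (pthRoot C p) ε β α y =
      ((cfHom p C n₂ β : B C) * (cfHom p C n₁ α : B C)).coeff (ptIndex y) := by
  have hn₁ : (0 : ℤ) < (n₁ : ℕ) := by exact_mod_cast n₁.pos
  have hn₂ : (0 : ℤ) < (n₂ : ℕ) := by exact_mod_cast n₂.pos
  have hq : (((n₂ + n₁ : ℕ+) : ℕ) : ℤ) = (n₁ : ℕ) + (n₂ : ℕ) := by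
    push_cast
    ring
  have hfst : ∀ (n : ℕ+) (x : ↥(lag 0 ∩ lag (n : ℕ))),
      ((((ptIndex x : ℤ) : ℝ) / ((n : ℕ) : ℤ) : ℝ) : UnitAddCircle) = (x : Torus).1 := by
    intro n x
    have h := intPt_fst n (ptIndex x)
    rw [intPt_ptIndex] at h
    rw [h]
    simp
  -- The right-hand side, expanded into a double sum over intersection points.
  have hR : ((cfHom p C n₂ β : B C) * (cfHom p C n₁ α : B C)).coeff (ptIndex y) =
      β.sum fun x₂ b => α.sum fun x₁ a =>
        ((thetaHom p C n₂ (ptIndex x₂) b : B C) * (thetaHom p C n₁ (ptIndex x₁) a : B C)).coeff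
          (ptIndex y) := by
    have hexp : ∀ (n : ℕ+) (γ : CFm C n), (cfHom p C n γ : B C) =
        γ.sum fun x c => (thetaHom p C n (ptIndex x) c : B C) := by
      intro n γ
      rw [cfHom, Finsupp.liftAddHom_apply, Finsupp.sum, AddSubgroup.val_finsetSum]
      rfl
    have hcoeff : ∀ (f : B C) (j : ℤ), f.coeff j = coeffHom j f := fun _ _ => rfl
    rw [hcoeff, hexp, hexp]
    exact map_finsuppSum_mul_finsuppSum (coeffHom (C := C) (ptIndex y)) β α _ _
  rw [hR, gradedProduct, triangleProduct, dehnCF, CFm.incl, CFm.incl,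
    Finsupp.sum_mapDomain_index_inj, Finsupp.sum_mapRange_index]
  · refine Finsupp.sum_congr fun x₂ _ => ?_
    rw [Finsupp.sum_mapRange_index]
    · refine Finsupp.sum_congr fun x₁ _ => ?_
      have h := hasSum_triangleTerm p hε (x₂ := dehn (n₁ : ℕ) x₂) hn₁ hn₂ hq y.2.1 y.2.2 x₁.2.1
        x₁.2.2 (dehn_mem_lag (by simp) x₂.2.1) (hfst _ y) (hfst _ x₁) (hfst _ x₂) (by positivity)
        (by exact_mod_cast ptIndex_lt y) (by positivity) (by exact_mod_cast ptIndex_lt x₁)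
        (by positivity) (by exact_mod_cast ptIndex_lt x₂) (β x₂).2 (α x₁).2
      rw [mul_comm]
      exact h.tsum_eq
    · intro x
      simp only [triangleTerm_zero_right, tsum_zero]
  · intro x
    simp only [triangleTerm_zero_left, tsum_zero, Finsupp.sum, Finset.sum_const_zero]
  · intro x x' h
    exact Subtype.ext (dehn_injective _ (congrArg Subtype.val h))

end Product

/-! ### The graded ring of Floer cochains -/

section Graded

variable (p : ℕ) [Fact p.Prime] {C : Type*} [NontriviallyNormedField C] [IsUltrametricDist C]
  [CompleteSpace C] [CharP C p] [PerfectRing C p]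

/-- The product of Floer cochains transported from the product of series. -/
def cfMul {n₂ n₁ : ℕ+} (β : CFm C n₂) (α : CFm C n₁) : CFm C (n₂ + n₁) :=
  (cfEquiv p (n₂ + n₁)).symm ⟨(cfHom p C n₂ β : B C) * (cfHom p C n₁ α : B C),
    SetLike.mul_mem_graded (A := eigen C p) (cfHom p C n₂ β).2 (cfHom p C n₁ α).2⟩

theorem coe_cfHom_cfMul {n₂ n₁ : ℕ+} (β : CFm C n₂) (α : CFm C n₁) :
    (cfHom p C (n₂ + n₁) (cfMul p β α) : B C) = (cfHom p C n₂ β : B C) * (cfHom p C n₁ α : B C) :=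
  congrArg Subtype.val ((cfEquiv p (n₂ + n₁)).apply_symm_apply _)

theorem cfMul_apply {n₂ n₁ : ℕ+} (β : CFm C n₂) (α : CFm C n₁)
    (y : ↥(lag 0 ∩ lag ((n₂ + n₁ : ℕ+) : ℕ))) : (cfMul p β α y : C) =
      ((cfHom p C n₂ β : B C) * (cfHom p C n₁ α : B C)).coeff (ptIndex y) := by
  rw [← coe_cfHom_cfMul, coeff_cfHom_natCast p _ _ (ptIndex_lt y), intPt_ptIndex]

theorem cfHom_coe_injective {n : ℕ+} {α β : CFm C n}
    (h : (cfHom p C n α : B C) = (cfHom p C n β : B C)) : α = β :=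
  (cfHom_bijective p n).1 (Subtype.ext h)

/-- The graded multiplication on `⨁_{n ≥ 1} CF(L_(0), L_(n); 𝔪)`. -/
abbrev cfGraded : DirectSum.GNonUnitalNonAssocSemiring (fun n : ℕ+ => CFm C n) where
  mul β α := cfMul p β α
  mul_zero a := cfHom_coe_injective p (by
    rw [coe_cfHom_cfMul, map_zero]
    exact (mul_zero _).trans (congrArg Subtype.val (map_zero (cfHom p C _))).symm)
  zero_mul a := cfHom_coe_injective p (by
    rw [coe_cfHom_cfMul, map_zero]
    exact (zero_mul _).trans (congrArg Subtype.val (map_zero (cfHom p C _))).symm)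
  mul_add a b c := cfHom_coe_injective p (by
    rw [coe_cfHom_cfMul, map_add, map_add, AddSubgroup.coe_add, AddSubgroup.coe_add, mul_add,
      coe_cfHom_cfMul, coe_cfHom_cfMul])
  add_mul a b c := cfHom_coe_injective p (by
    rw [coe_cfHom_cfMul, map_add, map_add, AddSubgroup.coe_add, AddSubgroup.coe_add, add_mul,
      coe_cfHom_cfMul, coe_cfHom_cfMul])

variable (C) in
/-- The additive map `⨁_{n ≥ 1} CF(L_(0), L_(n); 𝔪) → ⨁_{n ≥ 0} B^{φ = z ^ n}`. -/
def totalHom : (⨁ n : ℕ+, CFm C n) →+ FFRing C p :=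
  DirectSum.toAddMonoid fun n : ℕ+ =>
    (DirectSum.of (fun n : ℕ => eigen C p n) (n : ℕ)).comp (cfHom p C n)

theorem totalHom_of (n : ℕ+) (α : CFm C n) :
    totalHom p C (DirectSum.of (fun n : ℕ+ => CFm C n) n α) =
      DirectSum.of (fun n : ℕ => eigen C p n) (n : ℕ) (cfHom p C n α) := by
  rw [totalHom, DirectSum.toAddMonoid_of]
  rfl

theorem totalHom_apply (f : ⨁ n : ℕ+, CFm C n) (n : ℕ+) :
    totalHom p C f (n : ℕ) = cfHom p C n (f n) := by
  induction f using DirectSum.induction_on with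
  | zero => simp
  | of m α =>
    rw [totalHom_of]
    by_cases h : m = n
    · subst h
      rw [DirectSum.of_eq_same, DirectSum.of_eq_same]
    · rw [DirectSum.of_eq_of_ne _ _ _ (fun h' => h (PNat.coe_injective h'.symm)),
        DirectSum.of_eq_of_ne _ _ _ (Ne.symm h), map_zero]
  | add f g hf hg => rw [map_add, DirectSum.add_apply, DirectSum.add_apply, hf, hg, map_add]

theorem totalHom_apply_zero (f : ⨁ n : ℕ+, CFm C n) : totalHom p C f 0 = 0 := by
  induction f using DirectSum.induction_on with
  | zero => simp
  | of m α => rw [totalHom_of, DirectSum.of_eq_of_ne _ _ _ m.ne_zero.symm]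
  | add f g hf hg => rw [map_add, DirectSum.add_apply, hf, hg, add_zero]

theorem totalHom_injective : Function.Injective (totalHom p C) := by
  intro f g h
  refine DFinsupp.ext fun n => (cfHom_bijective p n).1 ?_
  rw [← totalHom_apply, ← totalHom_apply, h]

/-- The image of `totalHom` is the whole irrelevant ideal. -/
theorem mem_range_totalHom {f : FFRing C p} (hf : f 0 = 0) : ∃ g, totalHom p C g = f := by
  classical
  rw [← AddMonoidHom.mem_range, ← DirectSum.sum_support_of f]
  refine sum_mem fun i hi => ?_
  have hi0 : 0 < i := by
    refine Nat.pos_of_ne_zero ?_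
    rintro rfl
    exact (DFinsupp.mem_support_iff.mp hi) hf
  lift i to ℕ+ using hi0
  obtain ⟨α, hα⟩ := (cfHom_bijective (C := C) p i).2 (f i)
  exact ⟨DirectSum.of (fun n : ℕ+ => CFm C n) i α, by rw [totalHom_of, hα]⟩

theorem totalHom_mul (f g : ⨁ n : ℕ+, CFm C n) :
    letI := cfGraded (C := C) p
    totalHom p C (f * g) = totalHom p C f * totalHom p C g := by
  let := cfGraded (C := C) p
  change totalHom p C (f * g) = totalHom p C f * totalHom p C g
  induction f using DirectSum.induction_on with
  | zero => simp
  | add f f' hf hf' => rw [add_mul, map_add, map_add, hf, hf', add_mul]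
  | of m α =>
    induction g using DirectSum.induction_on with
    | zero => simp
    | add g g' hg hg' => rw [mul_add, map_add, map_add, hg, hg', mul_add]
    | of n β =>
      rw [DirectSum.of_mul_of, totalHom_of, totalHom_of, totalHom_of, DirectSum.of_mul_of]
      refine DirectSum.of_eq_of_gradedMonoid_eq ?_
      refine Sigma.subtype_ext (PNat.add_coe m n) ?_
      exact coe_cfHom_cfMul p α β

end Graded

end FloerFF

end

theorem mainTheorem2 (p : ℕ) [Fact p.Prime] (C : Type*) [NontriviallyNormedField C]
    [IsUltrametricDist C] [CompleteSpace C] [CharP C p] [IsAlgClosed C]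
    (ε : ℝ) (hε : Irrational ε) :
    (∀ (m n : ℕ+) (y : ↥(FloerFF.lag 0 ∩ FloerFF.lag ((m + n : ℕ+) : ℕ)))
        (x₂ : ↥(FloerFF.lag (m : ℕ) ∩ FloerFF.lag ((m + n : ℕ+) : ℕ)))
        (x₁ : ↥(FloerFF.lag 0 ∩ FloerFF.lag (m : ℕ))) (b a : C), ‖b‖ < 1 → ‖a‖ < 1 →
      Summable fun T : FloerFF.HolTriangle (FloerFF.lag 0) (FloerFF.lag (m : ℕ))
          (FloerFF.lag ((m + n : ℕ+) : ℕ)) y x₁ x₂ =>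
        FloerFF.triangleTerm (FloerFF.pthRoot C p) ε 0 (m : ℕ) ((m + n : ℕ+) : ℕ) b a T) ∧
    ∃ _ : DirectSum.GNonUnitalNonAssocSemiring (fun n : ℕ+ => FloerFF.CFm C n),
      (∀ (n₂ n₁ : ℕ+) (β : FloerFF.CFm C n₂) (α : FloerFF.CFm C n₁)
          (y : ↥(FloerFF.lag 0 ∩ FloerFF.lag ((n₂ + n₁ : ℕ+) : ℕ))),
        ((GradedMonoid.GMul.mul β α : FloerFF.CFm C (n₂ + n₁)) y : C) =
          FloerFF.gradedProduct (FloerFF.pthRoot C p) ε β α y) ∧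
      (∀ f g h : ⨁ n : ℕ+, FloerFF.CFm C n, f * g * h = f * (g * h)) ∧
      (∀ f g : ⨁ n : ℕ+, FloerFF.CFm C n, f * g = g * f) ∧
      ∃ Θ : (⨁ n : ℕ+, FloerFF.CFm C n) ≃+* ↥(FloerFF.irrelevantIdeal C p),
        (∀ (n : ℕ+) (α : FloerFF.CFm C n), ∃ g : FloerFF.eigen C p n,
          (Θ (DirectSum.of (fun n : ℕ+ => FloerFF.CFm C n) n α) : FloerFF.FFRing C p) =
            DirectSum.of (fun n : ℕ => FloerFF.eigen C p n) n g) ∧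
        ∀ (m : ℕ+) (k : ℕ), k < m → ∀ (a : FloerFF.maxIdeal C) (j : ℤ),
          ((Θ (DirectSum.of (fun n : ℕ+ => FloerFF.CFm C n) m
              (Finsupp.single (FloerFF.intPt m k) a)) : FloerFF.FFRing C p) m : FloerFF.B C).coeff j =
            FloerFF.theta (FloerFF.pthRoot C p) (m : ℕ) k a j := by
  let _inst := FloerFF.cfGraded (C := C) p
  have hmul : ∀ f g : ⨁ n : ℕ+, FloerFF.CFm C n, FloerFF.totalHom p C (f * g) =
      FloerFF.totalHom p C f * FloerFF.totalHom p C g := FloerFF.totalHom_mul p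
  refine ⟨fun m n y x₂ x₁ b a hb ha => FloerFF.summable_triangleTerm p hε m n y x₂ x₁ hb ha,
    _inst, fun n₂ n₁ β α y => ?_, fun f g h => ?_, fun f g => ?_,
    { toFun := fun f => ⟨FloerFF.totalHom p C f, FloerFF.totalHom_apply_zero p f⟩
      invFun := fun f => (FloerFF.mem_range_totalHom p f.2).choose
      left_inv := fun f => FloerFF.totalHom_injective p
        (FloerFF.mem_range_totalHom p (FloerFF.totalHom_apply_zero p f)).choose_spec
      right_inv := fun f => Subtype.ext (FloerFF.mem_range_totalHom p f.2).choose_spec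
      map_mul' := fun f g => Subtype.ext (hmul f g)
      map_add' := fun f g => Subtype.ext (map_add (FloerFF.totalHom p C) f g) },
    fun n α => ⟨FloerFF.cfHom p C n α, FloerFF.totalHom_of p n α⟩, fun m k hk a j => ?_⟩
  · rw [FloerFF.gradedProduct_eq_coeff p hε]
    exact FloerFF.cfMul_apply p β α y
  · apply FloerFF.totalHom_injective p
    rw [hmul, hmul, hmul, hmul, mul_assoc]
  · apply FloerFF.totalHom_injective p
    rw [hmul, hmul, mul_comm]
  · change ((FloerFF.totalHom p C (DirectSum.of (fun n : ℕ+ => FloerFF.CFm C n) m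
      (Finsupp.single (FloerFF.intPt m k) a)) (m : ℕ) : FloerFF.eigen C p m) : FloerFF.B C).coeff j = _
    rw [FloerFF.totalHom_of, DirectSum.of_eq_same, FloerFF.cfHom_single, FloerFF.coeff_thetaHom,
      FloerFF.ptIndex_intPt hk]
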